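/- Let $\mathbb{K}$ be an algebraically closed field and let $n\ge 4$. Let $Q^n$ be the type $D_n$ quiver with vertices $1,\dots,n$, one arrow $k+1\to k$ for each $1\le k\le n-2$, and one arrow $n\to n-2$. A representation of $Q^n$ assigns a finite-dimensional $\mathbb{K}$-vector space $V_k$ to each vertex $k$ and a linear map $f_a:V_{s(a)}\to V_{t(a)}$ to each arrow $a:s(a)\to t(a)$; it is indecomposable if it is nonzero and is not isomorphic to a direct sum of two nonzero representations. Let $\Sigma_n$ consist of the vertices of a regular $(2n-2)$-gon, labelled $1,2,\dots,n-1,-1,-2,\dots,-(n-1)$ in clockwise order, together with its centroid, which carries both labels $n$ and $-n$. For labels $i,j\in\{\pm1,\dots,\pm n\}$ with $j\ne\pm i$, the geodesic curve with endpoints $i$ and $j$ is the unoriented straight segment joining the points labelled $i$ and $j$, together with the unordered pair of labels $\{i,j\}$ (so a curve ending at $n$ is distinguished from a curve ending at $-n$). Call a geodesic curve $\gamma$ with endpoints $i,j$ equivalent to the geodesic curve $\gamma'$ with endpoints $-i,-j$, and let $\mathrm{Eq}(\Sigma_n)$ be the set of equivalence classes $[\gamma]=\{\gamma,\gamma'\}$.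 The essential curve of a class is the one having as an endpoint the smallest positive label that is an endpoint of either of its two curves. Given a class in $\mathrm{Eq}(\Sigma_n)$ whose essential curve $\gamma$ has endpoints $i$ and $j$, with $i$ its smallest positive endpoint (so $1\le i\le n-1$ and $i<|j|\le n$), define the representation $V(\gamma)=\left((V_k)_k,(f_a)_a\right)$ of $Q^n$ as follows. (a) If $i<j\le n-1$: $V_k=\mathbb{K}$ for $k\in\{i,\dots,j-1\}$ and $V_k=0$ otherwise; $f_a=\mathrm{id}$ if $s(a),t(a)\in\{i,\dots,j-1\}$ and $f_a=0$ otherwise. (b) If $-(n-1)\le j\le -(i+1)$: $V_k=\mathbb{K}^2$ for $-j\le k\le n-2$ (no such $k$ if $j=-(n-1)$), $V_k=\mathbb{K}$ for $k\in\{i,\dots,-j-1\}\cup\{n-1,n\}$, and $V_k=0$ otherwise. If $\dim V_{s(a)}=\dim V_{t(a)}\neq0$, then $f_a=\mathrm{id}$; if $\dim V_{s(a)}=1$ and $\dim V_{t(a)}=2$, then $f_a=\begin{bmatrix}1\\0\end{bmatrix}$ for the arrow $n-1\to n-2$ and $f_a=\begin{bmatrix}0\\1\end{bmatrix}$ for the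 arrow $n\to n-2$; if $\dim V_{s(a)}=2$ and $\dim V_{t(a)}=1$, then $f_a=\begin{bmatrix}1&1\end{bmatrix}$; and $f_a=0$ otherwise. (c) If $j=n$ (respectively $j=-n$): $V_k=\mathbb{K}$ for $k\in\{i,i+1,\dots,n-2\}\cup\{n\}$ (respectively $k\in\{i,i+1,\dots,n-2\}\cup\{n-1\}$), where $\{i,\dots,n-2\}=\emptyset$ if $i=n-1$, and $V_k=0$ otherwise; $f_a=\mathrm{id}$ if $\dim V_{s(a)}=\dim V_{t(a)}=1$ and $f_a=0$ otherwise. Then $[\gamma]\mapsto V(\gamma)$, where $\gamma$ is the essential curve of the class, induces a bijection from $\mathrm{Eq}(\Sigma_n)$ to the set of isomorphism classes of indecomposable representations of $Q^n$ over $\mathbb{K}$. -/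

import Mathlib

universe u v w

/-! ### Representations of quivers -/

/-- A representation of a quiver `Q` over a field `K`: a finite-dimensional vector space at
every vertex and a linear map for every arrow. -/
structure QuiverRep (K : Type u) [Field K] (Q : Type w) [Quiver.{v} Q] where
  space : Q → Type u
  [addCommGroup : ∀ k, AddCommGroup (space k)]
  [module : ∀ k, Module K (space k)]
  [finiteDimensional : ∀ k, FiniteDimensional K (space k)]
  map : ∀ {a b : Q}, (a ⟶ b) → (space a →ₗ[K] space b)

namespace QuiverRep

attribute [instance] addCommGroup module finiteDimensional

variable {K : Type u} [Field K] {Q : Type w} [Quiver.{v} Q]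

/-- Two representations are isomorphic if there are linear isomorphisms at all vertices that
commute with the maps along all arrows. -/
def IsIso (V W : QuiverRep K Q) : Prop :=
  ∃ e : ∀ k, V.space k ≃ₗ[K] W.space k,
    ∀ {a b : Q} (f : a ⟶ b) (x : V.space a), e b (V.map f x) = W.map f (e a x)

/-- The zero representations: all vector spaces vanish. -/
def IsZero (V : QuiverRep K Q) : Prop := ∀ k, Subsingleton (V.space k)

/-- The direct sum of two representations. -/
def directSum (V W : QuiverRep K Q) : QuiverRep K Q where
  space k := V.space k × W.space k
  map f := (V.map f).prodMap (W.map f)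

/-- A representation is indecomposable if it is nonzero and, whenever it is isomorphic to a
direct sum, one of the two summands is zero. -/
def IsIndecomposable (V : QuiverRep K Q) : Prop :=
  ¬ V.IsZero ∧ ∀ U W : QuiverRep K Q, V.IsIso (U.directSum W) → U.IsZero ∨ W.IsZero

theorem IsIso.refl (V : QuiverRep K Q) : V.IsIso V :=
  ⟨fun _ => LinearEquiv.refl K _, fun _ _ => rfl⟩

theorem IsIso.symm {V W : QuiverRep K Q} (h : V.IsIso W) : W.IsIso V := by
  obtain ⟨e, he⟩ := h
  refine ⟨fun k => (e k).symm, fun {a b} f x => ?_⟩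
  rw [LinearEquiv.symm_apply_eq, he, LinearEquiv.apply_symm_apply]

theorem IsIso.trans {U V W : QuiverRep K Q} (h : U.IsIso V) (h' : V.IsIso W) : U.IsIso W := by
  obtain ⟨e, he⟩ := h
  obtain ⟨e', he'⟩ := h'
  exact ⟨fun k => (e k).trans (e' k), fun f x => by simp [he, he']⟩

instance isoSetoid (K : Type u) [Field K] (Q : Type w) [Quiver.{v} Q] :
    Setoid (QuiverRep K Q) where
  r := IsIso
  iseqv := ⟨IsIso.refl, IsIso.symm, IsIso.trans⟩

/-- Isomorphism classes of representations of `Q` over `K`. -/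
abbrev IsoClass (K : Type u) [Field K] (Q : Type w) [Quiver.{v} Q] : Type _ :=
  Quotient (isoSetoid K Q)

end QuiverRep

/-- The vertices `1, …, n` of the quiver `Q^n`. -/
def DVertex (n : ℕ) : Type := {k : ℤ // 1 ≤ k ∧ k ≤ n}

/-- The number of a vertex. -/
def DVertex.num {n : ℕ} (k : DVertex n) : ℤ := k.1

/-- The type `D_n` quiver `Q^n`: one arrow `k + 1 ⟶ k` for each `1 ≤ k ≤ n - 2`, and one arrow
`n ⟶ n - 2`. -/
instance dQuiver (n : ℕ) : Quiver.{0} (DVertex n) where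
  Hom a b := PLift ((a.num = b.num + 1 ∧ b.num ≤ n - 2) ∨ (a.num = n ∧ b.num = n - 2))

/-! ### Curves on the punctured disk -/

/-- The labels `±1, …, ±n` of the marked points of `Σ_n`. -/
def IsLabel (n : ℕ) (i : ℤ) : Prop := 1 ≤ |i| ∧ |i| ≤ n

/-- The marked point with a given label: `n` and `-n` both label the centre `0`, and
`1, …, n-1, -1, …, -(n-1)` label, in clockwise order, the vertices of a regular `(2n-2)`-gon. -/
noncomputable def markedPoint (n : ℕ) (i : ℤ) : ℂ :=
  if |i| = n then 0
  else Complex.exp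
    (-(2 * Real.pi * ((if 0 < i then i - 1 else n - 2 - i : ℤ) : ℂ) / (2 * n - 2) * Complex.I))

/-- A geodesic curve on `Σ_n` (without orientation): the straight segment between the marked
points with labels `i` and `j`, where `j ≠ ± i`, together with the unordered pair of labels of its
endpoints. The labels matter: a curve ending in `n` differs from the one ending in `-n`. -/
structure GeodesicCurve (n : ℕ) where
  ends : Sym2 ℤ
  carrier : Set ℂ
  isGeodesic : ∃ i j : ℤ, IsLabel n i ∧ IsLabel n j ∧ j ≠ i ∧ j ≠ -i ∧ ends = s(i, j) ∧
    carrier = segment ℝ (markedPoint n i) (markedPoint n j)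

namespace GeodesicCurve

variable {n : ℕ}

/-- A geodesic curve is determined by the labels of its endpoints. -/
theorem ext_ends {γ δ : GeodesicCurve n} (h : γ.ends = δ.ends) : γ = δ := by
  revert h
  obtain ⟨e, c, i, j, -, -, -, -, he, hc⟩ := γ
  obtain ⟨e', c', i', j', -, -, -, -, he', hc'⟩ := δ
  intro h
  have h' : e = e' := h
  subst h'
  have hcc : c = c' := by
    rw [he, Sym2.eq_iff] at he'
    rcases he' with ⟨rfl, rfl⟩ | ⟨rfl, rfl⟩
    · rw [hc, hc']
    · rw [hc, hc', segment_symm]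
  subst hcc
  rfl

/-- The geodesic curve with endpoints labelled `i` and `j`. -/
noncomputable def mk' (i j : ℤ) (hi : IsLabel n i) (hj : IsLabel n j) (h : j ≠ i) (h' : j ≠ -i) :
    GeodesicCurve n :=
  ⟨s(i, j), segment ℝ (markedPoint n i) (markedPoint n j), i, j, hi, hj, h, h', rfl, rfl⟩

/-- `δ = γ'`: the endpoints of `δ` are `-i` and `-j` if those of `γ` are `i` and `j`. -/
def IsOpposite (γ δ : GeodesicCurve n) : Prop := δ.ends = γ.ends.map Neg.neg

theorem IsOpposite.symm {γ δ : GeodesicCurve n} (h : γ.IsOpposite δ) : δ.IsOpposite γ := by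
  unfold IsOpposite at *
  rw [h, Sym2.map_map]
  simp

/-- The equivalence relation on geodesic curves that identifies `γ` and `γ'`. -/
instance curveSetoid (n : ℕ) : Setoid (GeodesicCurve n) where
  r γ δ := γ = δ ∨ γ.IsOpposite δ
  iseqv := by
    refine ⟨fun γ => Or.inl rfl, ?_, ?_⟩
    · rintro γ δ (rfl | h)
      · exact Or.inl rfl
      · exact Or.inr h.symm
    · rintro γ δ ε (rfl | h) (rfl | h')
      · exact Or.inl rfl
      · exact Or.inr h'
      · exact Or.inr h
      · left
        apply ext_ends
        unfold IsOpposite at *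
        rw [h', h, Sym2.map_map]
        simp

end GeodesicCurve

/-- `Eq(Σ_n)`: the equivalence classes `[γ] = {γ, γ'}` of geodesic curves on `Σ_n`. -/
abbrev CurveClass (n : ℕ) : Type := Quotient (GeodesicCurve.curveSetoid n)

namespace CurveClass

variable {n : ℕ}

/-- The essential curve of the class `c` has endpoints `i` and `j`, where `i` is the smallest
positive endpoint of the curves in `c`. -/
def HasEssentialEnds (c : CurveClass n) (i j : ℤ) : Prop :=
  (∃ γ : GeodesicCurve n, ⟦γ⟧ = c ∧ γ.ends = s(i, j)) ∧ 0 < i ∧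
    ∀ δ : GeodesicCurve n, ⟦δ⟧ = c → ∀ k ∈ δ.ends, 0 < k → i ≤ k

theorem existsUnique_essentialEnds (c : CurveClass n) :
    ∃! p : ℤ × ℤ, c.HasEssentialEnds p.1 p.2 := by
  have key : ∀ (i j : ℤ) (γ : GeodesicCurve n), ⟦γ⟧ = c → γ.ends = s(i, j) →
      0 < i → i < |j| → c.HasEssentialEnds i j := by
    intro i j γ hγ he hi hij
    refine ⟨⟨γ, hγ, he⟩, hi, fun δ hδ k hk hk0 => ?_⟩
    rcases Quotient.exact (hγ.trans hδ.symm) with rfl | h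
    · rw [he, Sym2.mem_iff] at hk
      grind
    · rw [show δ.ends = _ from h, he, Sym2.map_mk, Sym2.mem_iff] at hk
      grind
  have main : ∃ i j : ℤ, c.HasEssentialEnds i j := by
    obtain ⟨γ, rfl⟩ := Quotient.exists_rep c
    have hγ : ∃ i j : ℤ, IsLabel n i ∧ IsLabel n j ∧ |i| < |j| ∧ γ.ends = s(i, j) := by
      obtain ⟨i, j, hi, hj, h1, h2, he, -⟩ := γ.isGeodesic
      by_cases hij : |i| < |j|
      · exact ⟨i, j, hi, hj, hij, he⟩
      · exact ⟨j, i, hj, hi, by grind, by rw [he, Sym2.eq_swap]⟩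
    obtain ⟨i, j, hi, hj, hij, he⟩ := hγ
    by_cases h0 : 0 < i
    · exact ⟨i, j, key i j γ rfl he h0 (by grind)⟩
    · have hi0 : 1 ≤ |i| := hi.1
      refine ⟨-i, -j, key (-i) (-j) (GeodesicCurve.mk' (-i) (-j) (by simpa [IsLabel] using hi)
        (by simpa [IsLabel] using hj) (by grind) (by grind)) ?_ rfl (by grind) (by grind)⟩
      apply Quotient.sound
      right
      apply GeodesicCurve.IsOpposite.symm
      simp [GeodesicCurve.IsOpposite, GeodesicCurve.mk', he]
  obtain ⟨i, j, h⟩ := main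
  refine ⟨(i, j), h, ?_⟩
  rintro ⟨i', j'⟩ h'
  obtain ⟨⟨γ, hγ, he⟩, h0, hmin⟩ := h
  obtain ⟨⟨δ, hδ, hd⟩, h0', hmin'⟩ := h'
  simp only at hd h0' hmin'
  have e1 : i ≤ i' := hmin δ hδ i' (by simp [hd]) h0'
  have e2 : i' ≤ i := hmin' γ hγ i (by simp [he]) h0
  obtain rfl : i = i' := le_antisymm e1 e2
  rcases Quotient.exact (hγ.trans hδ.symm) with rfl | hh
  · rw [he, Sym2.congr_right] at hd
    rw [hd]
  · obtain ⟨a, b, -, -, -, hab, hab', -⟩ := γ.isGeodesic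
    have hh' : δ.ends = γ.ends.map Neg.neg := hh
    rw [he, hd, Sym2.map_mk, Sym2.eq_iff] at hh'
    rw [he, Sym2.eq_iff] at hab'
    grind

/-- The endpoints `(i, j)` of the essential curve of a class, with `i` the smallest positive
endpoint. -/
noncomputable def essentialEnds (c : CurveClass n) : ℤ × ℤ :=
  c.existsUnique_essentialEnds.choose

theorem hasEssentialEnds (c : CurveClass n) :
    c.HasEssentialEnds c.essentialEnds.1 c.essentialEnds.2 :=
  c.existsUnique_essentialEnds.choose_spec.1

end CurveClass

/-! ### The representation of a curve -/

/-- The dimension of `V(γ)` at the vertex number `k`, if the essential curve `γ` has endpoints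
`i` and `j` and `i` is its smallest positive endpoint. The four branches are the cases
`i < j ≤ n-1`, then `j = n`, then `j = -n`, and `-(n-1) ≤ j < -i`. -/
def curveDim (n : ℕ) (i j k : ℤ) : ℕ :=
  if 0 < j ∧ j < n then
    if i ≤ k ∧ k ≤ j - 1 then 1 else 0
  else if j = n then
    if (i ≤ k ∧ k ≤ n - 2) ∨ k = n then 1 else 0
  else if j = -n then
    if (i ≤ k ∧ k ≤ n - 2) ∨ k = n - 1 then 1 else 0
  else
    if -j ≤ k ∧ k ≤ n - 2 then 2
    else if (i ≤ k ∧ k ≤ -j - 1) ∨ k = n - 1 ∨ k = n then 1 else 0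

/-- The matrix of `V(γ)` along an arrow from vertex number `a` to vertex number `b`: the identity
if the two dimensions agree; the columns `(1, 0)` and `(0, 1)` for the inclusions
of the lines at `n - 1` and at `n` into the plane at `n - 2`; the row `(1, 1)` from a plane to a
line; and zero otherwise. -/
def curveMatrix (K : Type u) [Field K] (n : ℕ) (i j a b : ℤ) :
    Matrix (Fin (curveDim n i j b)) (Fin (curveDim n i j a)) K :=
  Matrix.of fun r c =>
    if curveDim n i j a = curveDim n i j b then (if (r : ℕ) = c then 1 else 0)
    else if curveDim n i j a = 1 ∧ curveDim n i j b = 2 then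
      if a = n - 1 then (if (r : ℕ) = 0 then 1 else 0)
      else if a = n then (if (r : ℕ) = 1 then 1 else 0)
      else 0
    else if curveDim n i j a = 2 ∧ curveDim n i j b = 1 then 1
    else 0

/-- The representation of `Q^n` attached to the endpoints `i`, `j` of an essential curve. -/
noncomputable def repOfEnds (K : Type u) [Field K] (n : ℕ) (i j : ℤ) :
    QuiverRep K (DVertex n) where
  space k := Fin (curveDim n i j k.num) → K
  map {a b} _ := (curveMatrix K n i j a.num b.num).toLin'

/-- The representation `V(γ)`, which depends only on the class `[γ]`: it is defined through the
essential curve of the class. -/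
noncomputable def curveRep (K : Type u) [Field K] {n : ℕ} (c : CurveClass n) :
    QuiverRep K (DVertex n) :=
  repOfEnds K n c.essentialEnds.1 c.essentialEnds.2

/-! Essential curves correspond to the pairs `(i, j)` with `1 ≤ i ≤ n - 1` and `i < |j| ≤ n`, so
everything is a statement about the representations `repOfEnds K n i j`.

They are indecomposable because their endomorphisms are scalars: a scalar found on a line of the
support propagates along the arrows. In case (b) the lines at `n - 1` and `n` give two scalars,
which agree because both lines map onto the line at `i`. They are pairwise non-isomorphic because
the dimension vector determines `(i, j)`.

For surjectivity, an indecomposable `V` is isomorphic to each of its nonzero retracts, so it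
suffices to embed some `repOfEnds` in `V` together with a retraction. This amounts to vectors and
functionals of `V` that are compatible with the arrows and dual to each other (`isIso_repOfEnds`).
Paths in `Q^n` are unique, so such families arise by transporting a few vectors forward and pulling
a few functionals back.

Let `P` and `R` be the vertices `n - 1` and `n`. If the incoming arrows fail to generate some `V_g`
with `g ≤ n - 2`, a vector outside their span that dies as early as possible gives case (a).
Otherwise `V` is generated by `V_P` and `V_R`. If one of these does not embed in `V_{n-2}`, a simple
summand at `P` or `R` splits off. If both embed, let `v` be the smallest vertex at which both still
embed. A nonzero vector of `V_P` or `V_R` that dies below `v` either has image at `v` outside the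
image of the other space, which gives case (c), or is matched there by a vector of the other space.
In the latter situation a matching pair that agrees from `v` up to the largest possible vertex gives
case (b). In each case, extremality supplies the functionals. -/

namespace QuiverRep

/-! ### Retracts and indecomposability -/

variable {K : Type u} [Field K] {Q : Type w} [Quiver.{v} Q]

/-- The subrepresentation of `V` on the kernels of a morphism. -/
def kernel (V M : QuiverRep K Q) (p : ∀ k, V.space k →ₗ[K] M.space k)
    (hp : ∀ {a b : Q} (f : a ⟶ b) x, p b (V.map f x) = M.map f (p a x)) : QuiverRep K Q where
  space k := LinearMap.ker (p k)
  map {a b} f := (V.map f).restrict (fun x hx => by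
    rw [LinearMap.mem_ker] at hx ⊢
    rw [hp, hx, map_zero])

/-- A retract of a representation is a direct summand. -/
theorem isIso_directSum_kernel (V M : QuiverRep K Q)
    (s : ∀ k, M.space k →ₗ[K] V.space k)
    (hs : ∀ {a b : Q} (f : a ⟶ b) x, s b (M.map f x) = V.map f (s a x))
    (p : ∀ k, V.space k →ₗ[K] M.space k)
    (hp : ∀ {a b : Q} (f : a ⟶ b) x, p b (V.map f x) = M.map f (p a x))
    (hps : ∀ k x, p k (s k x) = x) : V.IsIso (M.directSum (V.kernel M p hp)) := by
  let r : ∀ k, V.space k →ₗ[K] LinearMap.ker (p k) := fun k =>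
    (LinearMap.id - (s k).comp (p k)).codRestrict (LinearMap.ker (p k)) fun x => by simp [hps]
  have hr : ∀ k x, (r k x : V.space k) = x - s k (p k x) := fun k x => rfl
  let E : ∀ k, V.space k ≃ₗ[K] (M.space k × LinearMap.ker (p k)) := fun k =>
    { toLinearMap := (p k).prod (r k)
      invFun := fun y => s k y.1 + y.2
      left_inv := fun x => by simp [hr]
      right_inv := fun y => by
        obtain ⟨m, w, hw⟩ := y
        rw [LinearMap.mem_ker] at hw
        refine Prod.ext ?_ (Subtype.ext ?_) <;> simp [hps, hw, hr] }
  refine ⟨E, fun {a b} f x => ?_⟩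
  refine Prod.ext ?_ (Subtype.ext ?_)
  · exact hp f x
  · change V.map f x - s b (p b (V.map f x)) = V.map f (x - s a (p a x))
    rw [map_sub, hp, hs]

/-- An indecomposable representation is isomorphic to each of its nonzero retracts. -/
theorem IsIndecomposable.isIso_of_retract {V M : QuiverRep K Q} (hV : V.IsIndecomposable)
    (hM : ¬ M.IsZero) (s : ∀ k, M.space k →ₗ[K] V.space k)
    (hs : ∀ {a b : Q} (f : a ⟶ b) x, s b (M.map f x) = V.map f (s a x))
    (p : ∀ k, V.space k →ₗ[K] M.space k)
    (hp : ∀ {a b : Q} (f : a ⟶ b) x, p b (V.map f x) = M.map f (p a x))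
    (hps : ∀ k x, p k (s k x) = x) : V.IsIso M := by
  -- The complement of the retract is the kernel of `p`, so its vanishing makes `p` injective.
  have hz := (hV.2 _ _ (isIso_directSum_kernel V M s hs p hp hps)).resolve_left hM
  refine ⟨fun k => LinearEquiv.ofBijective (p k) ⟨?_, fun x => ⟨s k x, hps k x⟩⟩, hp⟩
  rw [← LinearMap.ker_eq_bot]
  have := hz k
  exact Submodule.subsingleton_iff_eq_bot.mp this

/-- A nonzero representation all of whose endomorphisms are scalar is indecomposable. -/
theorem isIndecomposable_of_endomorphisms_scalar {V : QuiverRep K Q} (h0 : ¬ V.IsZero)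
    (h : ∀ e : ∀ k, V.space k →ₗ[K] V.space k,
      (∀ {a b : Q} (f : a ⟶ b) x, e b (V.map f x) = V.map f (e a x)) →
      ∃ c : K, ∀ k x, e k x = c • x) : V.IsIndecomposable := by
  refine ⟨h0, fun U W hUW => ?_⟩
  obtain ⟨E, hE⟩ : ∃ E : ∀ k, V.space k ≃ₗ[K] (U.space k × W.space k),
      ∀ {a b : Q} (f : a ⟶ b) (x : V.space a),
        E b (V.map f x) = (U.map f (E a x).1, W.map f (E a x).2) := hUW
  -- The projection onto the summand `U`, carried to `V`. If it is the scalar `c`, then `c = 0`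
  -- kills `U` and `c ≠ 0` kills `W`.
  let e : ∀ k, V.space k →ₗ[K] V.space k := fun k =>
    (E k).symm.toLinearMap ∘ₗ (LinearMap.inl K _ _ ∘ₗ LinearMap.fst K (U.space k) (W.space k)) ∘ₗ
      (E k).toLinearMap
  have he : ∀ k x, e k x = (E k).symm ((E k x).1, 0) := fun k x => rfl
  obtain ⟨c, hc⟩ := h e (by
    intro a b f x
    rw [he, he, LinearEquiv.symm_apply_eq, hE, hE, LinearEquiv.apply_symm_apply]
    simp)
  by_cases h0 : c = 0
  · left
    refine fun k => subsingleton_of_forall_eq 0 fun u => ?_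
    have h1 := hc k ((E k).symm (u, 0))
    rw [he, h0, zero_smul, LinearEquiv.apply_symm_apply, LinearEquiv.map_eq_zero_iff] at h1
    exact congrArg Prod.fst h1
  · right
    refine fun k => subsingleton_of_forall_eq 0 fun w => ?_
    have h1 := hc k ((E k).symm (0, w))
    rw [he, LinearEquiv.apply_symm_apply] at h1
    have h3 := (smul_eq_zero.mp (h1.symm.trans (map_zero (E k).symm))).resolve_left h0
    rw [LinearEquiv.map_eq_zero_iff] at h3
    exact congrArg Prod.snd h3

theorem IsIso.finrank_eq {V W : QuiverRep K Q} (h : V.IsIso W) (k : Q) :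
    Module.finrank K (V.space k) = Module.finrank K (W.space k) :=
  (h.choose k).finrank_eq

/-- The map of a representation along a path. -/
def mapPath (V : QuiverRep K Q) {a : Q} : ∀ {b : Q}, Quiver.Path a b → (V.space a →ₗ[K] V.space b)
  | _, .nil => LinearMap.id
  | _, .cons p f => (V.map f).comp (mapPath V p)

theorem mapPath_comp (V : QuiverRep K Q) {a b c : Q} (p : Quiver.Path a b)
    (q : Quiver.Path b c) : V.mapPath (p.comp q) = (V.mapPath q).comp (V.mapPath p) := by
  induction q with
  | nil => rfl
  | cons q f ih => rw [Quiver.Path.comp_cons, mapPath, ih, mapPath, LinearMap.comp_assoc]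

end QuiverRep

/-! ### Paths in `Q^n` and transport along them -/

namespace DVertex

variable {n : ℕ}

theorem ext_num {a b : DVertex n} (h : a.num = b.num) : a = b := Subtype.ext h

/-- The vertex with number `k`. -/
def ofNum (k : ℤ) (h : 1 ≤ k) (h' : k ≤ n) : DVertex n := ⟨k, h, h'⟩

@[simp]
theorem num_ofNum (k : ℤ) (h : 1 ≤ k) (h' : k ≤ n) : (ofNum k h h').num = k := rfl

theorem eq_ofNum (a : DVertex n) {k : ℤ} (h : a.num = k) (h1 : 1 ≤ k) (hn : k ≤ n) :
    a = ofNum k h1 hn := ext_num h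

/-- The arrows of `Q^n`. -/
def arrow {a b : DVertex n}
    (h : (a.num = b.num + 1 ∧ b.num ≤ n - 2) ∨ (a.num = n ∧ b.num = n - 2)) : a ⟶ b := ⟨h⟩

theorem arrow_iff {a b : DVertex n} (f : a ⟶ b) :
    (a.num = b.num + 1 ∧ b.num ≤ n - 2) ∨ (a.num = n ∧ b.num = n - 2) := f.down

theorem one_le (a : DVertex n) : 1 ≤ a.num := a.2.1

theorem le_n (a : DVertex n) : a.num ≤ n := a.2.2

/-- There is a path in `Q^n` from `a` to `b`. -/
def Reaches (a b : DVertex n) : Prop := a.num = b.num ∨ (b.num ≤ n - 2 ∧ b.num ≤ a.num)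

theorem nonempty_path {a b : DVertex n} (h : a.Reaches b) : Nonempty (Quiver.Path a b) := by
  obtain ⟨d, hd⟩ : ∃ d : ℕ, a.num - b.num = d := ⟨(a.num - b.num).toNat, by grind [Reaches]⟩
  induction d generalizing b with
  | zero =>
    obtain rfl : a = b := ext_num (by omega)
    exact ⟨.nil⟩
  | succ d ih =>
    have hb := b.one_le
    have ha := a.le_n
    have hab : b.num ≤ n - 2 := by grind [Reaches]
    by_cases hs : a.num = n ∧ b.num = n - 2
    · exact ⟨.cons .nil (PLift.up (Or.inr hs))⟩
    · let c : DVertex n := ⟨b.num + 1, by omega, by omega⟩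
      have hc : c.num = b.num + 1 := rfl
      obtain ⟨p⟩ := ih (b := c) (by unfold Reaches; omega) (by omega)
      exact ⟨.cons p (PLift.up (Or.inl ⟨rfl, hab⟩))⟩

theorem reaches_of_path {a b : DVertex n} (p : Quiver.Path a b) : a.Reaches b := by
  induction p with
  | nil => exact Or.inl rfl
  | @cons b c p f ih =>
    obtain ⟨f⟩ := f
    have := b.le_n
    unfold Reaches at *
    omega

/-- The last arrow of a path is forced: only `n - 2` has two incoming arrows, and their sources `n -
1` and `n` do not reach each other, so the starting vertex decides. -/
theorem path_eq {a b : DVertex n} (p q : Quiver.Path a b) : p = q := by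
  induction p with
  | nil =>
    cases q with
    | nil => rfl
    | @cons c _ q f =>
      have h := reaches_of_path q
      have := f.down
      unfold Reaches at h
      omega
  | @cons b c p f ih =>
    cases q with
    | nil =>
      have h := reaches_of_path p
      have := f.down
      unfold Reaches at h
      omega
    | @cons d _ q g =>
      obtain rfl : b = d := ext_num (by
        have h := reaches_of_path q
        have h' := reaches_of_path p
        have := f.down
        have := g.down
        have := a.le_n
        unfold Reaches at h h'
        omega)
      rw [ih q]
      obtain ⟨f⟩ := f
      obtain ⟨g⟩ := g
      rfl

end DVertex

namespace QuiverRep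

variable {K : Type u} [Field K] {n : ℕ}

open Classical in
/-- The map of a representation of `Q^n` along the path from `a` to `b`, and zero if there is no
such path. -/
noncomputable def transport (V : QuiverRep K (DVertex n)) (a b : DVertex n) :
    V.space a →ₗ[K] V.space b :=
  if h : a.Reaches b then V.mapPath (DVertex.nonempty_path h).some else 0

theorem transport_eq (V : QuiverRep K (DVertex n)) {a b : DVertex n} (p : Quiver.Path a b) :
    V.transport a b = V.mapPath p := by
  rw [transport, dif_pos (DVertex.reaches_of_path p)]
  exact congrArg _ (DVertex.path_eq _ _)

@[simp]
theorem transport_self (V : QuiverRep K (DVertex n)) (a : DVertex n) (x : V.space a) :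
    V.transport a a x = x := by
  rw [V.transport_eq .nil]
  rfl

theorem transport_trans (V : QuiverRep K (DVertex n)) {a b c : DVertex n} (hab : a.Reaches b)
    (hbc : b.Reaches c) (x : V.space a) :
    V.transport b c (V.transport a b x) = V.transport a c x := by
  obtain ⟨p⟩ := DVertex.nonempty_path hab
  obtain ⟨q⟩ := DVertex.nonempty_path hbc
  rw [V.transport_eq p, V.transport_eq q, V.transport_eq (p.comp q), mapPath_comp]
  rfl

theorem map_eq_transport (V : QuiverRep K (DVertex n)) {a b : DVertex n} (f : a ⟶ b)
    (x : V.space a) : V.map f x = V.transport a b x := by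
  rw [V.transport_eq f.toPath]
  rfl

theorem reaches_of_hom {a b : DVertex n} (f : a ⟶ b) : a.Reaches b :=
  DVertex.reaches_of_path f.toPath

end QuiverRep

/-! ### Essential pairs and dimension vectors -/

/-- The entries of `curveMatrix`, indexed by natural numbers. -/
def curveEntry (K : Type u) [Field K] (n : ℕ) (i j a b : ℤ) (r c : ℕ) : K :=
  if curveDim n i j a = curveDim n i j b then (if r = c then 1 else 0)
  else if curveDim n i j a = 1 ∧ curveDim n i j b = 2 then
    if a = n - 1 then (if r = 0 then 1 else 0)
    else if a = n then (if r = 1 then 1 else 0)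
    else 0
  else if curveDim n i j a = 2 ∧ curveDim n i j b = 1 then 1
  else 0

theorem curveMatrix_toLin'_apply (K : Type u) [Field K] (n : ℕ) (i j a b : ℤ)
    (x : Fin (curveDim n i j a) → K) (r : Fin (curveDim n i j b)) :
    (curveMatrix K n i j a b).toLin' x r =
      ∑ c : Fin (curveDim n i j a), curveEntry K n i j a b r c * x c := rfl

/-- The endpoints `(i, j)` of essential curves. -/
def IsEssentialPair (n : ℕ) (i j : ℤ) : Prop := 1 ≤ i ∧ i ≤ n - 1 ∧ i < |j| ∧ |j| ≤ n

theorem curveDim_of_pos {n : ℕ} {j : ℤ} (h : 0 < j) (h' : j < n) (i k : ℤ) :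
    curveDim n i j k = if i ≤ k ∧ k ≤ j - 1 then 1 else 0 :=
  if_pos ⟨h, h'⟩

theorem curveDim_of_eq {n : ℕ} (i k : ℤ) :
    curveDim n i n k = if (i ≤ k ∧ k ≤ n - 2) ∨ k = n then 1 else 0 := by
  simp [curveDim]

theorem curveDim_of_eq_neg {n : ℕ} (hn : 0 < n) (i k : ℤ) :
    curveDim n i (-n) k = if (i ≤ k ∧ k ≤ n - 2) ∨ k = n - 1 then 1 else 0 := by
  rw [curveDim, if_neg (by omega), if_neg (by omega), if_pos rfl]

theorem curveDim_of_neg {n : ℕ} {j : ℤ} (h : j < 0) (h' : -n < j) (i k : ℤ) :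
    curveDim n i j k = if -j ≤ k ∧ k ≤ n - 2 then 2
      else if (i ≤ k ∧ k ≤ -j - 1) ∨ k = n - 1 ∨ k = n then 1 else 0 := by
  rw [curveDim, if_neg (by omega), if_neg (by omega), if_neg (by omega)]

theorem IsEssentialPair.cases {n : ℕ} {i j : ℤ} (h : IsEssentialPair n i j) :
    (0 < j ∧ j < n ∧ i < j) ∨ j = n ∨ j = -n ∨ (j < 0 ∧ -n < j ∧ i < -j) := by
  obtain ⟨h1, h2, h3, h4⟩ := h
  rcases abs_cases j with h | h <;> omega

theorem IsEssentialPair.not_isZero {n : ℕ} {i j : ℤ} (h : IsEssentialPair n i j) (K : Type u)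
    [Field K] : ¬ (repOfEnds K n i j).IsZero := by
  obtain ⟨k, hk⟩ : ∃ k : DVertex n, 0 < curveDim n i j k.num := by
    have hc := h.cases
    obtain ⟨h1, h2, -, -⟩ := h
    rcases hc with ⟨p, q, r⟩ | rfl | rfl | ⟨p, q, r⟩
    · exact ⟨.ofNum i (by omega) (by omega), by
        rw [curveDim_of_pos p q]; simp only [DVertex.num_ofNum]; grind⟩
    · exact ⟨.ofNum n (by omega) (by omega), by simp [curveDim_of_eq]⟩
    · exact ⟨.ofNum (n - 1) (by omega) (by omega), by
        simp [curveDim_of_eq_neg (show 0 < n by omega)]⟩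
    · exact ⟨.ofNum n (by omega) (by omega), by simp [curveDim_of_neg p q]⟩
  intro hz
  have : Subsingleton (Fin (curveDim n i j k.num) → K) := hz k
  have h1 := congrFun (Subsingleton.elim (fun _ : Fin (curveDim n i j k.num) => (1 : K)) 0) ⟨0, hk⟩
  exact one_ne_zero h1

theorem IsEssentialPair.eq_of_curveDim_eq {n : ℕ} {i j i' j' : ℤ} (h : IsEssentialPair n i j)
    (h' : IsEssentialPair n i' j')
    (hd : ∀ k : ℤ, 1 ≤ k → k ≤ n → curveDim n i j k = curveDim n i' j' k) : i = i' ∧ j = j' := by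
  have hc := h.cases
  have hc' := h'.cases
  obtain ⟨h1, h2, -, -⟩ := h
  obtain ⟨h1', h2', -, -⟩ := h'
  -- The dimensions at `n - 1` and `n` are `(0,0)`, `(0,1)`, `(1,0)`, `(1,1)` for `0 < j < n`, `j =
  -- n`, `j = -n` and `-n < j < 0`, so they separate the four cases. Within a case, the ends of the
  -- support and of the planes recover `i` and `j`.
  have A := hd (n - 1) (by omega) (by omega)
  have B := hd n (by omega) (by omega)
  have hi := hd i (by omega) (by omega)
  have hi' := hd i' (by omega) (by omega)
  rcases hc with ⟨p, q, r⟩ | rfl | rfl | ⟨p, q, r⟩ <;>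
    rcases hc' with ⟨p', q', r'⟩ | rfl | rfl | ⟨p', q', r'⟩
  all_goals
    first
    | have hj := hd (j - 1) (by omega) (by omega)
      have hj' := hd (j' - 1) (by omega) (by omega)
    | have hj := hd (-j) (by omega) (by omega)
      have hj' := hd (-j') (by omega) (by omega)
    | skip
    simp only [curveDim_of_pos, curveDim_of_neg, curveDim_of_eq,
      curveDim_of_eq_neg (show 0 < n by omega), *] at *
    grind

theorem DVertex.chain_induction {n : ℕ} {P : DVertex n → Prop} {i t : ℤ}
    (h0 : ∀ k : DVertex n, k.num = t → P k) (ht : t ≤ n - 1)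
    (step : ∀ a b : DVertex n, (a ⟶ b) → a.num = b.num + 1 → i ≤ b.num → a.num ≤ t → P a → P b)
    (k : DVertex n) (hi : i ≤ k.num) (hk : k.num ≤ t) : P k := by
  obtain ⟨d, hd⟩ : ∃ d : ℕ, t - k.num = d := ⟨(t - k.num).toNat, by omega⟩
  induction d generalizing k with
  | zero => exact h0 k (by omega)
  | succ d ih =>
    have hk1 := k.one_le
    let a : DVertex n := .ofNum (k.num + 1) (by omega) (by omega)
    have ha : a.num = k.num + 1 := rfl
    exact step a k (DVertex.arrow (Or.inl ⟨ha, by omega⟩)) ha hi (by omega)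
      (ih a (by omega) (by omega) (by omega))

/-! ### Splitting off the representation of a curve -/

namespace QuiverRep

variable {K : Type u} [Field K] {n : ℕ} {V : QuiverRep K (DVertex n)}

/-- The vectors `y` are the images of the standard basis under a morphism into `V`, and the
functionals `ψ` are the coordinates of a morphism out of `V`. Duality makes the second a retraction
of the first. -/
theorem IsIndecomposable.isIso_repOfEnds (hV : V.IsIndecomposable) {i j : ℤ}
    (hij : IsEssentialPair n i j)
    (y : ∀ k : DVertex n, ℕ → V.space k) (ψ : ∀ k : DVertex n, ℕ → V.space k →ₗ[K] K)
    (hy : ∀ {a b : DVertex n} (f : a ⟶ b), ∀ c < curveDim n i j a.num, V.map f (y a c) =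
      ∑ r ∈ Finset.range (curveDim n i j b.num), curveEntry K n i j a.num b.num r c • y b r)
    (hψ : ∀ {a b : DVertex n} (f : a ⟶ b), ∀ r < curveDim n i j b.num, ∀ x, ψ b r (V.map f x) =
      ∑ c ∈ Finset.range (curveDim n i j a.num), curveEntry K n i j a.num b.num r c * ψ a c x)
    (h : ∀ k, ∀ r < curveDim n i j k.num, ∀ c < curveDim n i j k.num,
      ψ k r (y k c) = if r = c then 1 else 0) :
    V.IsIso (repOfEnds K n i j) := by
  let s : ∀ k : DVertex n, (Fin (curveDim n i j k.num) → K) →ₗ[K] V.space k := fun k =>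
    Fintype.linearCombination K (fun r : Fin (curveDim n i j k.num) => y k r)
  let p : ∀ k : DVertex n, V.space k →ₗ[K] (Fin (curveDim n i j k.num) → K) := fun k =>
    LinearMap.pi fun r => ψ k r
  have hs : ∀ {a b : DVertex n} (f : a ⟶ b) (x : Fin (curveDim n i j a.num) → K),
      s b ((curveMatrix K n i j a.num b.num).toLin' x) = V.map f (s a x) := by
    intro a b f x
    simp only [s, Fintype.linearCombination_apply, map_sum, map_smul, curveMatrix_toLin'_apply,
      hy f _ (Fin.is_lt _), Finset.sum_smul, Finset.smul_sum, smul_smul]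
    rw [Finset.sum_comm]
    refine Finset.sum_congr rfl fun c _ => ?_
    rw [Finset.sum_range]
    exact Finset.sum_congr rfl fun r _ => by rw [mul_comm]
  have hp : ∀ {a b : DVertex n} (f : a ⟶ b) (x : V.space a),
      p b (V.map f x) = (curveMatrix K n i j a.num b.num).toLin' (p a x) := by
    intro a b f x
    refine funext fun r => ?_
    refine (hψ f r r.2 x).trans ?_
    rw [Finset.sum_range, curveMatrix_toLin'_apply]
    rfl
  have hps : ∀ (k : DVertex n) (x : Fin (curveDim n i j k.num) → K), p k (s k x) = x := by
    intro k x
    refine funext fun r => ?_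
    simp only [p, s, LinearMap.pi_apply, Fintype.linearCombination_apply, map_sum, map_smul,
      h k r r.2 _ (Fin.is_lt _)]
    simp [← Fin.ext_iff]
  exact hV.isIso_of_retract (hij.not_isZero K) s hs p hp hps

theorem IsIndecomposable.isIso_repOfEnds_of_thin (hV : V.IsIndecomposable) {i j : ℤ}
    (hij : IsEssentialPair n i j) (S : DVertex n → Prop) [DecidablePred S]
    (hS : ∀ k, curveDim n i j k.num = if S k then 1 else 0)
    (y : ∀ k : DVertex n, V.space k) (ψ : ∀ k : DVertex n, V.space k →ₗ[K] K)
    (hy : ∀ {a b : DVertex n} (f : a ⟶ b), S a → S b → V.map f (y a) = y b)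
    (hy0 : ∀ {a b : DVertex n} (f : a ⟶ b), S a → ¬ S b → V.map f (y a) = 0)
    (hψ : ∀ {a b : DVertex n} (f : a ⟶ b), S a → S b → ∀ x, ψ b (V.map f x) = ψ a x)
    (hψ0 : ∀ {a b : DVertex n} (f : a ⟶ b), ¬ S a → S b → ∀ x, ψ b (V.map f x) = 0)
    (h : ∀ k, S k → ψ k (y k) = 1) :
    V.IsIso (repOfEnds K n i j) := by
  refine hV.isIso_repOfEnds hij (fun k _ => y k) (fun k _ => ψ k) ?_ ?_ ?_
  · intro a b f c hc
    have ha := hS a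
    have hb := hS b
    by_cases hSa : S a <;> by_cases hSb : S b <;>
      simp_all [curveEntry]
  · intro a b f c hc x
    have ha := hS a
    have hb := hS b
    by_cases hSa : S a <;> by_cases hSb : S b <;>
      simp_all [curveEntry]
  · intro k r hr c hc
    have hk := hS k
    by_cases hSk : S k
    · simp_all
    · simp_all

end QuiverRep

/-! ### Endomorphisms of the representation of a curve -/

section

variable (K : Type u) [Field K] (n : ℕ) (i j : ℤ)

/-- The standard basis vectors of the spaces of `repOfEnds`, indexed by natural numbers. -/
def curveBasis (k : ℤ) (c : ℕ) : Fin (curveDim n i j k) → K :=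
  fun r => if (r : ℕ) = c then 1 else 0

variable {K n i j}

theorem curveMatrix_toLin'_curveBasis {a b : ℤ} {c : ℕ} (hc : c < curveDim n i j a) :
    (curveMatrix K n i j a b).toLin' (curveBasis K n i j a c) =
      ∑ r ∈ Finset.range (curveDim n i j b),
        curveEntry K n i j a b r c • curveBasis K n i j b r := by
  funext r
  rw [curveMatrix_toLin'_apply, Finset.sum_range, Finset.sum_apply,
    Finset.sum_eq_single ⟨c, hc⟩, Finset.sum_eq_single r]
  · simp [curveBasis]
  · intro s _ hs
    have : (r : ℕ) ≠ s := fun h => hs (Fin.ext h.symm)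
    simp [curveBasis, this]
  · simp
  · intro s _ hs
    have : (s : ℕ) ≠ c := fun h => hs (Fin.ext h)
    simp [curveBasis, this]
  · simp

theorem eq_sum_curveBasis (k : ℤ) (x : Fin (curveDim n i j k) → K) :
    x = ∑ r : Fin (curveDim n i j k), x r • curveBasis K n i j k r := by
  funext s
  simp [curveBasis, ← Fin.ext_iff]

/-- An endomorphism of a space of `repOfEnds` that multiplies all standard basis vectors by the same
scalar is scalar. -/
theorem eq_smul_of_curveBasis {k : ℤ} {e : (Fin (curveDim n i j k) → K) →ₗ[K] _} {c : K}
    (h : ∀ r < curveDim n i j k, e (curveBasis K n i j k r) = c • curveBasis K n i j k r)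
    (x : Fin (curveDim n i j k) → K) : e x = c • x := by
  conv_lhs => rw [eq_sum_curveBasis k x]
  conv_rhs => rw [eq_sum_curveBasis k x]
  rw [map_sum, Finset.smul_sum]
  refine Finset.sum_congr rfl fun r _ => ?_
  rw [map_smul, h r r.2, smul_comm]

theorem curveBasis_ne_zero {k : ℤ} {r : ℕ} (h : r < curveDim n i j k) :
    curveBasis K n i j k r ≠ 0 := fun h0 => by
  simpa [curveBasis] using congrFun h0 ⟨r, h⟩

theorem exists_eq_smul_of_curveDim_eq_one {k : ℤ} (h : curveDim n i j k = 1)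
    (x : Fin (curveDim n i j k) → K) : ∃ c : K, x = c • curveBasis K n i j k 0 := by
  refine ⟨x ⟨0, by omega⟩, funext fun r => ?_⟩
  obtain rfl : r = ⟨0, by omega⟩ := Fin.ext (by have := r.2; simp only; omega)
  simp [curveBasis]

end

section

variable {K : Type u} [Field K] {n : ℕ} {i j : ℤ}

theorem curveMatrix_toLin'_curveBasis_of_eq {a b : ℤ} {r : ℕ} (hr : r < curveDim n i j a)
    (h : curveDim n i j a = curveDim n i j b) :
    (curveMatrix K n i j a b).toLin' (curveBasis K n i j a r) = curveBasis K n i j b r := by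
  rw [curveMatrix_toLin'_curveBasis hr, Finset.sum_eq_single r]
  · simp [curveEntry, h]
  · intro s _ hs
    simp [curveEntry, h, hs]
  · intro hs
    simp only [Finset.mem_range, not_lt] at hs
    omega

theorem curveMatrix_toLin'_curveBasis_two_one {a b : ℤ} {r : ℕ} (hr : r < 2)
    (ha : curveDim n i j a = 2) (hb : curveDim n i j b = 1) :
    (curveMatrix K n i j a b).toLin' (curveBasis K n i j a r) = curveBasis K n i j b 0 := by
  rw [curveMatrix_toLin'_curveBasis (by omega)]
  simp [curveEntry, ha, hb]

theorem curveMatrix_toLin'_curveBasis_one_two {a b : ℤ}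
    (ha : curveDim n i j a = 1) (hb : curveDim n i j b = 2) (han : a = n - 1 ∨ a = n) :
    (curveMatrix K n i j a b).toLin' (curveBasis K n i j a 0) =
      curveBasis K n i j b (if a = n - 1 then 0 else 1) := by
  rw [curveMatrix_toLin'_curveBasis (by omega)]
  have he (r : ℕ) : curveEntry K n i j a b r 0 = if a = n - 1 then (if r = 0 then 1 else 0)
      else if a = n then (if r = 1 then 1 else 0) else 0 := by simp [curveEntry, ha, hb]
  simp only [hb, he]
  by_cases h : a = n - 1
  · simp [h]
  · have hn : (n : ℤ) ≠ n - 1 := by omega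
    simp [han.resolve_left h, hn]

variable (K n i j) in
/-- Families of linear maps `E` which act by a scalar on `curveBasis K n i j b s` whenever they do
so on a preimage of this vector in the standard basis at the source of an arrow to `b`. -/
def PropagatesScalars (E : ∀ k : DVertex n, (Fin (curveDim n i j k.num) → K) →ₗ[K]
    (Fin (curveDim n i j k.num) → K)) : Prop :=
  ∀ {a b : DVertex n} (_ : a ⟶ b) (r s : ℕ) (c : K),
    (curveMatrix K n i j a.num b.num).toLin' (curveBasis K n i j a.num r) =
      curveBasis K n i j b.num s →
    E a (curveBasis K n i j a.num r) = c • curveBasis K n i j a.num r →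
    E b (curveBasis K n i j b.num s) = c • curveBasis K n i j b.num s

theorem isIndecomposable_repOfEnds_of_propagatesScalars (h : ¬ (repOfEnds K n i j).IsZero)
    (H : ∀ E, PropagatesScalars K n i j E → ∃ c : K, ∀ k : DVertex n,
      ∀ r < curveDim n i j k.num,
        E k (curveBasis K n i j k.num r) = c • curveBasis K n i j k.num r) :
    (repOfEnds K n i j).IsIndecomposable := by
  refine QuiverRep.isIndecomposable_of_endomorphisms_scalar h fun e he => ?_
  -- This only retypes `e` so that its spaces are visibly `Fin _ → K`.
  obtain ⟨E, hE, rfl⟩ : ∃ E : ∀ k : DVertex n, (Fin (curveDim n i j k.num) → K) →ₗ[K]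
      (Fin (curveDim n i j k.num) → K),
      (∀ {a b : DVertex n} (f : a ⟶ b) (x : Fin (curveDim n i j a.num) → K),
        E b ((curveMatrix K n i j a.num b.num).toLin' x) =
          (curveMatrix K n i j a.num b.num).toLin' (E a x)) ∧ E = e := ⟨e, he, rfl⟩
  obtain ⟨c, hc⟩ := H E fun {a b} f r s c hm ha => by rw [← hm, hE f, ha, map_smul]
  exact ⟨c, fun k x => eq_smul_of_curveBasis (hc k) x⟩

variable {E : ∀ k : DVertex n, (Fin (curveDim n i j k.num) → K) →ₗ[K]
    (Fin (curveDim n i j k.num) → K)}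

theorem exists_apply_curveBasis_eq_smul {k : DVertex n} (hk : curveDim n i j k.num = 1) :
    ∃ c : K, E k (curveBasis K n i j k.num 0) = c • curveBasis K n i j k.num 0 :=
  exists_eq_smul_of_curveDim_eq_one hk _

/-- Here `s k` is the index of the basis vector followed at vertex `k` on the way down from `t` to
`i`. -/
theorem PropagatesScalars.chain (hE : PropagatesScalars K n i j E) {c : K} {t : ℤ} (ht : t ≤ n - 1)
    (s : ℤ → ℕ)
    (h0 : ∀ k : DVertex n, k.num = t →
      E k (curveBasis K n i j k.num (s k.num)) = c • curveBasis K n i j k.num (s k.num))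
    (hs : ∀ k, i ≤ k → k + 1 ≤ t →
      (curveMatrix K n i j (k + 1) k).toLin' (curveBasis K n i j (k + 1) (s (k + 1))) =
        curveBasis K n i j k (s k)) (k : DVertex n) (hi : i ≤ k.num) (hk : k.num ≤ t) :
    E k (curveBasis K n i j k.num (s k.num)) = c • curveBasis K n i j k.num (s k.num) := by
  refine DVertex.chain_induction (P := fun k => E k (curveBasis K n i j k.num (s k.num)) =
    c • curveBasis K n i j k.num (s k.num)) h0 ht ?_ k hi hk
  intro a b f hab hib hat ha
  refine hE f _ _ c ?_ ha
  have := hs b.num hib (by omega)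
  rwa [← hab] at this

end

namespace IsEssentialPair

variable {K : Type u} [Field K] {n : ℕ} {i j : ℤ}
  {E : ∀ k : DVertex n, (Fin (curveDim n i j k.num) → K) →ₗ[K] (Fin (curveDim n i j k.num) → K)}

theorem scalar_of_pos (h : IsEssentialPair n i j) (h0 : 0 < j) (hn : j < n)
    (hE : PropagatesScalars K n i j E) :
    ∃ c : K, ∀ k : DVertex n, ∀ r < curveDim n i j k.num,
      E k (curveBasis K n i j k.num r) = c • curveBasis K n i j k.num r := by
  obtain ⟨h1, h2, h3, -⟩ := h
  rw [abs_of_pos h0] at h3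
  have hd := curveDim_of_pos h0 hn
  obtain ⟨c, hc⟩ := exists_apply_curveBasis_eq_smul (E := E)
    (k := .ofNum (j - 1) (by omega) (by omega)) (by rw [hd, DVertex.num_ofNum]; grind)
  refine ⟨c, fun k s hs => ?_⟩
  rw [hd] at hs
  obtain rfl : s = 0 := by grind
  refine hE.chain (t := j - 1) (by omega) (fun _ => 0) ?_ ?_ k (by grind) (by grind)
  · intro k hk
    rw [k.eq_ofNum hk (by omega) (by omega)]
    exact hc
  · intro k hk hkt
    have ha : curveDim n i j (k + 1) = 1 := by rw [hd]; grind
    have hb : curveDim n i j k = 1 := by rw [hd]; grind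
    exact curveMatrix_toLin'_curveBasis_of_eq (by omega) (by omega)

theorem scalar_of_eq (h : IsEssentialPair n i j) (hj : j = n)
    (hE : PropagatesScalars K n i j E) :
    ∃ c : K, ∀ k : DVertex n, ∀ r < curveDim n i j k.num,
      E k (curveBasis K n i j k.num r) = c • curveBasis K n i j k.num r := by
  obtain ⟨h1, h2, -, -⟩ := h
  have hd : ∀ k, curveDim n i j k = if (i ≤ k ∧ k ≤ n - 2) ∨ k = n then 1 else 0 := fun k => by
    rw [hj, curveDim_of_eq]
  obtain ⟨c, hc⟩ := exists_apply_curveBasis_eq_smul (E := E)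
    (k := .ofNum n (by omega) (by omega)) (by rw [hd, DVertex.num_ofNum]; grind)
  refine ⟨c, fun k s hs => ?_⟩
  rw [hd] at hs
  obtain rfl : s = 0 := by grind
  by_cases hk : k.num = n
  · rw [k.eq_ofNum hk (by omega) (by omega)]
    exact hc
  refine hE.chain (t := n - 2) (by omega) (fun _ => 0) ?_ ?_ k (by grind) (by grind)
  · intro b hb
    refine hE (DVertex.arrow (Or.inr ⟨rfl, hb⟩)) _ _ c ?_ hc
    have ha : curveDim n i j n = 1 := by rw [hd]; grind
    have hb : curveDim n i j b.num = 1 := by rw [hd]; grind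
    rw [DVertex.num_ofNum]
    exact curveMatrix_toLin'_curveBasis_of_eq (by omega) (by omega)
  · intro k hk hkt
    have ha : curveDim n i j (k + 1) = 1 := by rw [hd]; grind
    have hb : curveDim n i j k = 1 := by rw [hd]; grind
    exact curveMatrix_toLin'_curveBasis_of_eq (by omega) (by omega)

theorem scalar_of_eq_neg (h : IsEssentialPair n i j) (hj : j = -n)
    (hE : PropagatesScalars K n i j E) :
    ∃ c : K, ∀ k : DVertex n, ∀ r < curveDim n i j k.num,
      E k (curveBasis K n i j k.num r) = c • curveBasis K n i j k.num r := by
  obtain ⟨h1, h2, -, -⟩ := h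
  have hd : ∀ k, curveDim n i j k = if (i ≤ k ∧ k ≤ n - 2) ∨ k = n - 1 then 1 else 0 := fun k => by
    rw [hj, curveDim_of_eq_neg (by omega)]
  obtain ⟨c, hc⟩ := exists_apply_curveBasis_eq_smul (E := E)
    (k := .ofNum (n - 1) (by omega) (by omega)) (by rw [hd, DVertex.num_ofNum]; grind)
  refine ⟨c, fun k s hs => ?_⟩
  rw [hd] at hs
  obtain rfl : s = 0 := by grind
  refine hE.chain (t := n - 1) (by omega) (fun _ => 0) ?_ ?_ k (by grind) (by grind)
  · intro k hk
    rw [k.eq_ofNum hk (by omega) (by omega)]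
    exact hc
  · intro k hk hkt
    have ha : curveDim n i j (k + 1) = 1 := by rw [hd]; grind
    have hb : curveDim n i j k = 1 := by rw [hd]; grind
    exact curveMatrix_toLin'_curveBasis_of_eq (by omega) (by omega)

/-- Two chains of basis vectors, starting at `n - 1` and at `n`, stay independent through the planes
and merge in the lines below `-j`, which forces their scalars to coincide. -/
theorem scalar_of_neg (h : IsEssentialPair n i j) (h0 : j < 0) (hn : -n < j)
    (hE : PropagatesScalars K n i j E) :
    ∃ c : K, ∀ k : DVertex n, ∀ r < curveDim n i j k.num,
      E k (curveBasis K n i j k.num r) = c • curveBasis K n i j k.num r := by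
  obtain ⟨h1, h2, h3, -⟩ := h
  rw [abs_of_neg h0] at h3
  have hd := curveDim_of_neg h0 hn i
  have hd2 : ∀ k, -j ≤ k → k ≤ n - 2 → curveDim n i j k = 2 := fun k _ _ => by rw [hd]; grind
  have hd1 : ∀ k, i ≤ k → k ≤ -j - 1 → curveDim n i j k = 1 := fun k _ _ => by rw [hd]; grind
  have hdn1 : curveDim n i j (n - 1) = 1 := by rw [hd]; grind
  have hdn : curveDim n i j n = 1 := by rw [hd]; grind
  obtain ⟨c, hc⟩ := exists_apply_curveBasis_eq_smul (E := E)
    (k := .ofNum (n - 1) (by omega) (by omega)) hdn1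
  obtain ⟨c', hc'⟩ := exists_apply_curveBasis_eq_smul (E := E)
    (k := .ofNum n (by omega) (by omega)) hdn
  have key : ∀ k : DVertex n, i ≤ k.num → k.num ≤ n - 1 →
      E k (curveBasis K n i j k.num 0) = c • curveBasis K n i j k.num 0 := by
    refine hE.chain (t := n - 1) (by omega) (fun _ => 0) ?_ ?_
    · intro k hk
      rw [k.eq_ofNum hk (by omega) (by omega)]
      exact hc
    · intro k hk hkt
      by_cases hkj : -j ≤ k
      · by_cases hkn : k = n - 2
        · obtain rfl : k = n - 2 := hkn
          have ha : curveDim n i j (n - 2 + 1) = 1 := by rw [← hdn1]; congr 1; omega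
          rw [curveMatrix_toLin'_curveBasis_one_two ha (hd2 _ hkj (by omega)) (by omega),
            if_pos (by omega)]
        · have := hd2 k (by omega) (by omega)
          have := hd2 (k + 1) (by omega) (by omega)
          exact curveMatrix_toLin'_curveBasis_of_eq (by omega) (by omega)
      · have hb := hd1 k (by omega) (by omega)
        -- The bound `k < n - 2` excludes `j = -(n - 1)`, where there are no planes and `n - 1` maps
        -- to `n - 2` by the identity of a line.
        by_cases hkj' : k = -j - 1 ∧ k < n - 2
        · exact curveMatrix_toLin'_curveBasis_two_one (by omega)
            (hd2 (k + 1) (by omega) (by omega)) hb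
        · have ha : curveDim n i j (k + 1) = 1 := by rw [hd]; grind
          exact curveMatrix_toLin'_curveBasis_of_eq (by omega) (by omega)
  have key' : ∀ k : DVertex n, i ≤ k.num → k.num ≤ n - 2 →
      E k (curveBasis K n i j k.num (if -j ≤ k.num then 1 else 0)) =
        c' • curveBasis K n i j k.num (if -j ≤ k.num then 1 else 0) := by
    refine hE.chain (t := n - 2) (by omega) (fun k => if -j ≤ k then 1 else 0) ?_ ?_
    · intro b hb
      refine hE (DVertex.arrow (Or.inr ⟨rfl, hb⟩)) _ _ c' ?_ hc'
      rw [DVertex.num_ofNum]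
      by_cases hbj : -j ≤ b.num
      · rw [curveMatrix_toLin'_curveBasis_one_two hdn (hd2 _ hbj (by omega)) (by omega),
          if_neg (by omega), if_pos hbj]
      · have := hd1 b.num (by omega) (by omega)
        rw [if_neg hbj]
        exact curveMatrix_toLin'_curveBasis_of_eq (by omega) (by omega)
    · intro k hk hkt
      by_cases hkj : -j ≤ k
      · have := hd2 k (by omega) (by omega)
        have := hd2 (k + 1) (by omega) (by omega)
        rw [if_pos (by omega), if_pos hkj]
        exact curveMatrix_toLin'_curveBasis_of_eq (by omega) (by omega)
      · have hb := hd1 k (by omega) (by omega)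
        rw [if_neg hkj]
        by_cases hkj' : k = -j - 1
        · rw [if_pos (by omega)]
          exact curveMatrix_toLin'_curveBasis_two_one (by omega)
            (hd2 (k + 1) (by omega) (by omega)) hb
        · have ha := hd1 (k + 1) (by omega) (by omega)
          rw [if_neg (by omega)]
          exact curveMatrix_toLin'_curveBasis_of_eq (by omega) (by omega)
  -- Both chains end in the same nonzero vector at `i`, where the dimension is 1.
  obtain rfl : c = c' := by
    have e1 := key (.ofNum i (by omega) (by omega)) le_rfl h2
    have e2 := key' (.ofNum i (by omega) (by omega)) le_rfl (by rw [DVertex.num_ofNum]; omega)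
    rw [if_neg (by rw [DVertex.num_ofNum]; omega)] at e2
    have := hd1 i le_rfl (by omega)
    exact smul_left_injective K (curveBasis_ne_zero (by rw [DVertex.num_ofNum]; omega)) (e1.symm.trans e2)
  refine ⟨c, fun k s hs => ?_⟩
  rw [hd] at hs
  by_cases hk : k.num = n
  · rw [k.eq_ofNum hk (by omega) (by omega)]
    obtain rfl : s = 0 := by grind
    exact hc'
  · by_cases hs0 : s = 0
    · subst hs0
      exact key k (by grind) (by grind)
    · have := key' k (by grind) (by grind)
      rwa [if_pos (by grind), show 1 = s by grind] at this

variable (K) in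
theorem isIndecomposable (h : IsEssentialPair n i j) : (repOfEnds K n i j).IsIndecomposable := by
  refine isIndecomposable_repOfEnds_of_propagatesScalars (h.not_isZero K) fun E hE => ?_
  rcases h.cases with ⟨p, q, -⟩ | hj | hj | ⟨p, q, -⟩
  exacts [h.scalar_of_pos p q hE, h.scalar_of_eq hj hE, h.scalar_of_eq_neg hj hE,
    h.scalar_of_neg p q hE]

end IsEssentialPair

/-! ### Curve summands of an indecomposable representation -/

namespace QuiverRep

variable {K : Type u} [Field K] {n : ℕ} {V : QuiverRep K (DVertex n)}

theorem target_le {a b : DVertex n} (f : a ⟶ b) : b.num ≤ n - 2 := by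
  have := DVertex.arrow_iff f
  omega

theorem map_transport (V : QuiverRep K (DVertex n)) {a b c : DVertex n} (h : a.Reaches b)
    (f : b ⟶ c) (x : V.space a) : V.map f (V.transport a b x) = V.transport a c x := by
  rw [map_eq_transport, transport_trans V h (reaches_of_hom f)]

theorem transport_map (V : QuiverRep K (DVertex n)) {a b c : DVertex n} (f : a ⟶ b)
    (h : b.Reaches c) (x : V.space a) : V.transport b c (V.map f x) = V.transport a c x := by
  rw [map_eq_transport, transport_trans V (reaches_of_hom f) h]

theorem transport_eq_zero (V : QuiverRep K (DVertex n)) {a b : DVertex n} (h : ¬ a.Reaches b)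
    (x : V.space a) : V.transport a b x = 0 := by
  rw [transport, dif_neg h, LinearMap.zero_apply]

theorem exists_functional_of_notMem {X : Type u} [AddCommGroup X] [Module K X] {p : Submodule K X}
    {x : X} (hx : x ∉ p) : ∃ φ : X →ₗ[K] K, φ x = 1 ∧ ∀ y ∈ p, φ y = 0 := by
  obtain ⟨f, hf, hp⟩ := Submodule.exists_le_ker_of_notMem hx
  refine ⟨(f x)⁻¹ • f, by simp [hf], fun y hy => ?_⟩
  have : f y = 0 := hp hy
  simp [this]

/-- The case in which the arrows ending at `g` do not jointly generate the space at `g`. -/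
theorem IsIndecomposable.exists_isIso_of_incoming (hV : V.IsIndecomposable) (g : DVertex n)
    (hg : g.num ≤ n - 2) (I : Submodule K (V.space g))
    (hI : ∀ (a : DVertex n) (f : a ⟶ g) x, V.map f x ∈ I) (hI' : I ≠ ⊤) :
    ∃ i j, IsEssentialPair n i j ∧ V.IsIso (repOfEnds K n i j) := by
  have hg1 := g.one_le
  -- The vector `x` outside `I` is chosen to die as early as possible on its way down; `i` is the
  -- last vertex at which it may survive.
  obtain ⟨i, ⟨hi1, hig, x, hx, hxz⟩, hmax⟩ := Int.exists_greatest_of_bdd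
    (P := fun z => 1 ≤ z ∧ z ≤ g.num ∧ ∃ x ∉ I, ∀ b : DVertex n, b.num < z →
      V.transport g b x = 0) ⟨g.num, fun z hz => hz.2.1⟩ (by
      obtain ⟨x, -, hx⟩ := SetLike.exists_of_lt hI'.lt_top
      exact ⟨1, le_rfl, hg1, x, hx, fun b hb => absurd b.one_le (by omega)⟩)
  let v : DVertex n := .ofNum i (by omega) (by omega)
  have hv : v.num = i := rfl
  have hgv : g.Reaches v := by unfold DVertex.Reaches; omega
  -- If `x` agreed at `v` with some `y` in `I`, then `x - y` would lie outside `I` and die earlier.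
  -- For `v = g` it would be zero, hence in `I`.
  have hxI : V.transport g v x ∉ I.map (V.transport g v) := by
    rintro ⟨y, hy, hxy⟩
    have hne : x - y ∉ I := fun h => hx (by simpa using I.add_mem h hy)
    have h0 : V.transport g v (x - y) = 0 := by rw [map_sub, hxy, sub_self]
    by_cases hig' : i = g.num
    · have hvg : v = g := DVertex.ext_num hig'
      clear_value v
      subst hvg
      rw [transport_self] at h0
      exact hne (h0 ▸ I.zero_mem)
    · have := hmax (i + 1) ⟨by omega, by omega, x - y, hne, fun b hb => by
        rw [← V.transport_trans hgv (c := b) (by unfold DVertex.Reaches; omega), h0, map_zero]⟩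
      omega
  obtain ⟨φ, hφ, hφI⟩ := exists_functional_of_notMem hxI
  have hp : IsEssentialPair n i (g.num + 1) := by
    refine ⟨hi1, by omega, ?_, ?_⟩ <;> rw [abs_of_pos (by omega)] <;> omega
  refine ⟨i, g.num + 1, hp, hV.isIso_repOfEnds_of_thin hp
    (fun k => i ≤ k.num ∧ k.num ≤ g.num) (fun k => ?_) (fun k => V.transport g k x)
    (fun k => φ ∘ₗ V.transport k v) ?_ ?_ ?_ ?_ ?_⟩
  · rw [curveDim_of_pos (by omega) (by omega), add_sub_cancel_right]
  · intro a b f ha hb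
    exact V.map_transport (by unfold DVertex.Reaches; omega) f x
  · intro a b f ha hb
    have := DVertex.arrow_iff f
    rw [V.map_transport (by unfold DVertex.Reaches; omega), hxz b (by omega)]
  · intro a b f ha hb z
    exact congrArg φ (V.transport_map f (by unfold DVertex.Reaches; omega) z)
  · intro a b f ha hb z
    have := DVertex.arrow_iff f
    obtain rfl : b = g := DVertex.ext_num (by omega)
    exact hφI _ (Submodule.mem_map_of_mem (hI a f z))
  · intro k hk
    exact (congrArg φ (V.transport_trans (by unfold DVertex.Reaches; omega)
      (by unfold DVertex.Reaches; omega) x)).trans hφ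

/-- The case of a curve ending in the puncture. -/
theorem IsIndecomposable.exists_isIso_of_puncture (hV : V.IsIndecomposable) (hn : 4 ≤ n)
    {g v : DVertex n} (hg : n - 1 ≤ g.num) (hgv : g.Reaches v) (x : V.space g)
    (hx : ∀ b, (v ⟶ b) → V.transport g b x = 0) (φ : V.space v →ₗ[K] K)
    (hφ : φ (V.transport g v x) = 1)
    (hφ' : ∀ a : DVertex n, n - 1 ≤ a.num → a.num ≠ g.num → a.Reaches v → ∀ z,
      φ (V.transport a v z) = 0) :
    ∃ i j, IsEssentialPair n i j ∧ V.IsIso (repOfEnds K n i j) := by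
  have hgn := g.le_n
  have hv1 := v.one_le
  have hvn := v.le_n
  let S : DVertex n → Prop := fun k => k.num = g.num ∨ (v.num ≤ k.num ∧ k.num ≤ n - 2)
  have hgS : ∀ k, S k → g.Reaches k := fun k hk => by simp only [S, DVertex.Reaches] at *; omega
  have hSv : ∀ k, S k → k.Reaches v := fun k hk => by simp only [S, DVertex.Reaches] at *; omega
  -- The minimum matters only for `v = g = n`: the support is then `{n}`, and the curve starts at
  -- the label `n - 1`.
  obtain ⟨j, hp, hS⟩ : ∃ j, IsEssentialPair n (min v.num (n - 1)) j ∧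
      ∀ k : DVertex n, curveDim n (min v.num (n - 1)) j k.num = if S k then 1 else 0 := by
    by_cases h : g.num = n
    · refine ⟨n, ⟨by omega, by omega, by rw [abs_of_pos] <;> omega, by rw [abs_of_pos]; omega⟩,
        fun k => ?_⟩
      rw [curveDim_of_eq]
      refine if_congr ?_ rfl rfl
      simp only [S]
      omega
    · refine ⟨-n, ⟨by omega, by omega, by rw [abs_of_neg] <;> omega, by rw [abs_of_neg] <;> omega⟩,
        fun k => ?_⟩
      rw [curveDim_of_eq_neg (by omega)]
      refine if_congr ?_ rfl rfl
      simp only [S]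
      omega
  refine ⟨_, j, hp, hV.isIso_repOfEnds_of_thin hp S hS (fun k => V.transport g k x)
    (fun k => φ ∘ₗ V.transport k v) ?_ ?_ ?_ ?_ ?_⟩
  · intro a b f ha hb
    exact V.map_transport (hgS a ha) f x
  · intro a b f ha hb
    rw [V.map_transport (hgS a ha)]
    have := DVertex.arrow_iff f
    obtain rfl : a = v := DVertex.ext_num (by
      simp only [S, DVertex.Reaches] at ha hb hgv; omega)
    exact hx b f
  · intro a b f ha hb z
    exact congrArg φ (V.transport_map f (hSv b hb) z)
  · intro a b f ha hb z
    refine (congrArg φ (V.transport_map f (hSv b hb) z)).trans ?_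
    have := DVertex.arrow_iff f
    simp only [S, DVertex.Reaches] at ha hb hgv
    exact hφ' a (by omega) (by omega) (by unfold DVertex.Reaches; omega) z
  · intro k hk
    exact (congrArg φ (V.transport_trans (hgS k hk) (hSv k hk) x)).trans hφ

end QuiverRep

section

variable {K : Type u} [Field K] {n : ℕ} {i j : ℤ}

theorem curveEntry_of_eq {a b : ℤ} (h : curveDim n i j a = curveDim n i j b) (r c : ℕ) :
    curveEntry K n i j a b r c = if r = c then 1 else 0 := by
  simp [curveEntry, h]

theorem curveEntry_two_one {a b : ℤ} (ha : curveDim n i j a = 2) (hb : curveDim n i j b = 1)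
    (r c : ℕ) : curveEntry K n i j a b r c = 1 := by
  simp [curveEntry, ha, hb]

theorem curveEntry_one_two {a b : ℤ} (ha : curveDim n i j a = 1) (hb : curveDim n i j b = 2)
    (r c : ℕ) : curveEntry K n i j a b r c = if a = n - 1 then (if r = 0 then 1 else 0)
      else if a = n then (if r = 1 then 1 else 0) else 0 := by
  simp [curveEntry, ha, hb]

end

namespace QuiverRep

variable {K : Type u} [Field K] {n : ℕ} {V : QuiverRep K (DVertex n)}

/-- `Φ` on `A` and zero on `B` agree on `A ⊓ B`, so they glue on `A ⊔ B` and extend to `X`. -/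
theorem exists_functional_eq_on {X : Type u} [AddCommGroup X] [Module K X] {A B : Submodule K X}
    (Φ : X →ₗ[K] K) (h : ∀ z ∈ A ⊓ B, Φ z = 0) :
    ∃ α : X →ₗ[K] K, (∀ z ∈ A, α z = Φ z) ∧ ∀ z ∈ B, α z = 0 := by
  let f : X →ₗ.[K] K := ⟨A, Φ.domRestrict A⟩
  let g : X →ₗ.[K] K := ⟨B, 0⟩
  have hfg : ∀ (x : f.domain) (y : g.domain), (x : X) = y → f x = g y := fun x y hxy =>
    h x ⟨x.2, hxy ▸ y.2⟩
  obtain ⟨α, hα⟩ := (f.sup g hfg).toFun.exists_extend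
  refine ⟨α, fun z hz => ?_, fun z hz => ?_⟩
  · have h1 := LinearMap.congr_fun hα ⟨z, Submodule.mem_sup_left hz⟩
    exact h1.trans ((f.sup_apply hfg ⟨z, hz⟩ 0 ⟨z, _⟩ (by simp)).trans
      (by simp [f]))
  · have h1 := LinearMap.congr_fun hα ⟨z, Submodule.mem_sup_right hz⟩
    exact h1.trans ((f.sup_apply hfg 0 ⟨z, hz⟩ ⟨z, _⟩ (by simp)).trans
      (by simp [g]))

/-- The case of a curve with endpoints of opposite signs. -/
theorem IsIndecomposable.isIso_of_neg (hV : V.IsIndecomposable)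
    {P R v w : DVertex n} (hP : P.num = n - 1) (hR : R.num = n) (hvn : v.num ≤ n - 2)
    (hvw : v.num < w.num) (hw : w.num ≤ n - 1) (x : V.space P) (y : V.space R)
    (hxy : ∀ k : DVertex n, k.num < w.num → k.num ≤ n - 2 → V.transport P k x = V.transport R k y)
    (hx : ∀ k : DVertex n, k.num < v.num → V.transport P k x = 0)
    (φ : V.space v →ₗ[K] K) (hφ : φ (V.transport P v x) = 1)
    (α : V.space w →ₗ[K] K) (hα : ∀ z, α (V.transport P w z) = φ (V.transport P v z))
    (hα' : ∀ z, α (V.transport R w z) = 0) :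
    IsEssentialPair n v.num (-w.num) ∧ V.IsIso (repOfEnds K n v.num (-w.num)) := by
  have hv1 := v.one_le
  have hp : IsEssentialPair n v.num (-w.num) :=
    ⟨hv1, by omega, by rw [abs_of_neg] <;> omega, by rw [abs_of_neg] <;> omega⟩
  have hd := curveDim_of_neg (n := n) (j := -w.num) (by omega) (by omega) v.num
  rw [neg_neg] at hd
  have hd2 : ∀ k, w.num ≤ k → k ≤ n - 2 → curveDim n v.num (-w.num) k = 2 :=
    fun k _ _ => by rw [hd, if_pos (by omega)]
  have hd1 : ∀ k, v.num ≤ k → k ≤ w.num - 1 → curveDim n v.num (-w.num) k = 1 :=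
    fun k _ _ => by rw [hd, if_neg (by omega), if_pos (by omega)]
  have hdP : curveDim n v.num (-w.num) P.num = 1 := by
    rw [hd, if_neg (by omega), if_pos (by omega)]
  have hdR : curveDim n v.num (-w.num) R.num = 1 := by
    rw [hd, if_neg (by omega), if_pos (by omega)]
  have hd0 : ∀ k, k < v.num → curveDim n v.num (-w.num) k = 0 :=
    fun k _ => by rw [hd, if_neg (by omega), if_neg (by omega)]
  -- In the planes the basis consists of the transports of `x` and `y`, with dual basis `α`, `φ - α`
  -- (pulled back), since `α` takes the values 1, 0 on them and `φ` the values 1, 1. In the lines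
  -- below, `x` and `y` agree and `φ` alone remains.
  let Y : ∀ k : DVertex n, ℕ → V.space k := fun k r =>
    if k.num = n then V.transport R k y else
      if r = 0 then V.transport P k x else V.transport R k y
  let Ψ : ∀ k : DVertex n, ℕ → V.space k →ₗ[K] K := fun k r =>
    if w.num ≤ k.num ∧ k.num ≤ n - 2 then
      if r = 0 then α ∘ₗ V.transport k w else φ ∘ₗ V.transport k v - α ∘ₗ V.transport k w
    else φ ∘ₗ V.transport k v
  have hYR : ∀ r, Y R r = y := fun r => by simp [Y, hR]
  have hY0 : ∀ k : DVertex n, k.num ≤ n - 1 → Y k 0 = V.transport P k x := fun k hk => by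
    simp only [Y]
    rw [if_neg (by omega), if_pos trivial]
  have hY1 : ∀ k : DVertex n, k.num ≤ n - 1 → Y k 1 = V.transport R k y := fun k hk => by
    simp only [Y]
    rw [if_neg (by omega), if_neg one_ne_zero]
  have hΨ0 : ∀ k : DVertex n, w.num ≤ k.num → k.num ≤ n - 2 → ∀ z,
      Ψ k 0 z = α (V.transport k w z) := fun k _ _ z => by
    simp only [Ψ]
    rw [if_pos (by omega), if_pos trivial]
    rfl
  have hΨ1 : ∀ k : DVertex n, w.num ≤ k.num → k.num ≤ n - 2 → ∀ z,
      Ψ k 1 z = φ (V.transport k v z) - α (V.transport k w z) := fun k _ _ z => by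
    simp only [Ψ]
    rw [if_pos (by omega), if_neg one_ne_zero]
    rfl
  have hΨ : ∀ k : DVertex n, k.num < w.num ∨ n - 1 ≤ k.num → ∀ z,
      Ψ k 0 z = φ (V.transport k v z) := fun k _ z => by
    simp only [Ψ]
    rw [if_neg (by omega)]
    rfl
  clear_value Y Ψ
  have hPr : ∀ k : DVertex n, k.num ≤ n - 1 → P.Reaches k := fun k _ => by
    unfold DVertex.Reaches; omega
  have hRr : ∀ k : DVertex n, k.num ≤ n - 2 → R.Reaches k := fun k _ => by
    unfold DVertex.Reaches; omega
  have hrv : ∀ k : DVertex n, v.num ≤ k.num → k.Reaches v := fun k _ => by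
    unfold DVertex.Reaches; omega
  have hrw : ∀ k : DVertex n, w.num ≤ k.num → w.num ≤ n - 2 → k.Reaches w := fun k _ _ => by
    unfold DVertex.Reaches; omega
  have hφR : w.num ≤ n - 2 → φ (V.transport R v y) = 1 := fun _ => by
    rw [← hxy v hvw hvn, hφ]
  refine ⟨hp, hV.isIso_repOfEnds hp Y Ψ ?_ ?_ ?_⟩
  · intro a b f c hc
    have hb := target_le f
    by_cases hbv : b.num < v.num
    · rw [hd0 b.num hbv, Finset.sum_range_zero]
      rcases DVertex.arrow_iff f with ⟨hab, -⟩ | ⟨ha, hb'⟩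
      · by_cases hav : a.num < v.num
        · rw [hd0 _ hav] at hc
          omega
        · rw [hd1 _ (by omega) (by omega)] at hc
          obtain rfl : c = 0 := by omega
          rw [hY0 _ (by omega), V.map_transport (hPr a (by omega)), hx b hbv]
      · omega
    by_cases hbw : b.num < w.num
    · have hdb := hd1 b.num (by omega) (by omega)
      rw [hdb, Finset.sum_range_one, hY0 _ (by omega)]
      by_cases haR : a.num = n
      · obtain rfl : a = R := DVertex.ext_num (by omega)
        rw [hdR] at hc
        obtain rfl : c = 0 := by omega
        rw [curveEntry_of_eq (by omega), hYR, if_pos rfl, one_smul, hxy b hbw (by omega),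
          map_eq_transport]
      · have hab := DVertex.arrow_iff f
        by_cases ha2 : w.num ≤ a.num ∧ a.num ≤ n - 2
        · have hda := hd2 a.num ha2.1 ha2.2
          rw [curveEntry_two_one hda hdb, one_smul]
          rw [hda] at hc
          interval_cases c
          · rw [hY0 _ (by omega), V.map_transport (hPr a (by omega))]
          · rw [hY1 _ (by omega), V.map_transport (hRr a (by omega)), hxy b hbw (by omega)]
        · have hda : curveDim n v.num (-w.num) a.num = 1 := by
            rw [hd, if_neg (by omega), if_pos (by omega)]
          rw [hda] at hc
          obtain rfl : c = 0 := by omega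
          rw [curveEntry_of_eq (by omega), if_pos rfl, one_smul, hY0 _ (by omega),
            V.map_transport (hPr a (by omega))]
    · have hdb := hd2 b.num (by omega) (by omega)
      rw [hdb, Finset.sum_range_succ, Finset.sum_range_one, hY0 _ (by omega), hY1 _ (by omega)]
      by_cases haR : a.num = n
      · obtain rfl : a = R := DVertex.ext_num (by omega)
        rw [hdR] at hc
        obtain rfl : c = 0 := by omega
        rw [curveEntry_one_two hdR hdb, curveEntry_one_two hdR hdb, if_neg (by omega),
          if_pos hR, if_neg (by omega), if_neg (by omega), if_pos hR, if_pos rfl, zero_smul,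
          one_smul, zero_add, hYR, map_eq_transport]
      by_cases haP : a.num = n - 1
      · obtain rfl : a = P := DVertex.ext_num (by omega)
        rw [hdP] at hc
        obtain rfl : c = 0 := by omega
        rw [curveEntry_one_two hdP hdb, curveEntry_one_two hdP hdb, if_pos hP, if_pos rfl,
          if_pos hP, if_neg (by omega), zero_smul, one_smul, add_zero, hY0 _ (by omega),
          transport_self, map_eq_transport]
      · have hab := DVertex.arrow_iff f
        have hda := hd2 a.num (by omega) (by omega)
        rw [curveEntry_of_eq (by omega), curveEntry_of_eq (by omega)]
        rw [hda] at hc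
        interval_cases c
        · simp [hY0 a (by omega), V.map_transport (hPr a (by omega))]
        · simp [hY1 a (by omega), V.map_transport (hRr a (by omega))]
  · intro a b f r hr z
    have hb := target_le f
    by_cases hbv : b.num < v.num
    · rw [hd0 b.num hbv] at hr
      omega
    have hab := DVertex.arrow_iff f
    by_cases hbw : b.num < w.num
    · have hdb := hd1 b.num (by omega) (by omega)
      rw [hdb] at hr
      obtain rfl : r = 0 := by omega
      rw [hΨ b (Or.inl hbw), V.transport_map f (hrv b (by omega))]
      by_cases ha2 : w.num ≤ a.num ∧ a.num ≤ n - 2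
      · have hda := hd2 a.num ha2.1 ha2.2
        rw [hda, Finset.sum_range_succ, Finset.sum_range_one, curveEntry_two_one hda hdb,
          curveEntry_two_one hda hdb, hΨ0 a ha2.1 ha2.2, hΨ1 a ha2.1 ha2.2]
        ring
      · have hda : curveDim n v.num (-w.num) a.num = 1 := by
          rw [hd, if_neg (by omega), if_pos (by omega)]
        rw [hda, Finset.sum_range_one, curveEntry_of_eq (by omega), if_pos rfl, one_mul,
          hΨ a (by omega)]
    · have hdb := hd2 b.num (by omega) (by omega)
      rw [hdb] at hr
      have e0 : Ψ b 0 (V.map f z) = α (V.transport a w z) := by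
        rw [hΨ0 b (by omega) hb, V.transport_map f (hrw b (by omega) (by omega))]
      have e1 : Ψ b 1 (V.map f z) = φ (V.transport a v z) - α (V.transport a w z) := by
        rw [hΨ1 b (by omega) hb, V.transport_map f (hrw b (by omega) (by omega)),
          V.transport_map f (hrv b (by omega))]
      by_cases haR : a.num = n
      · obtain rfl : a = R := DVertex.ext_num (by omega)
        rw [hdR, Finset.sum_range_one, curveEntry_one_two hdR hdb, if_neg (by omega), if_pos hR,
          hΨ a (by omega)]
        interval_cases r
        · rw [e0, hα']
          simp
        · rw [e1, hα']
          simp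
      by_cases haP : a.num = n - 1
      · obtain rfl : a = P := DVertex.ext_num (by omega)
        rw [hdP, Finset.sum_range_one, curveEntry_one_two hdP hdb, if_pos hP, hΨ a (by omega)]
        interval_cases r
        · rw [e0, hα]
          simp
        · rw [e1, hα]
          simp
      · have hda := hd2 a.num (by omega) (by omega)
        rw [hda, Finset.sum_range_succ, Finset.sum_range_one, curveEntry_of_eq (by omega),
          curveEntry_of_eq (by omega), hΨ0 a (by omega) (by omega), hΨ1 a (by omega) (by omega)]
        interval_cases r
        · rw [e0]
          simp
        · rw [e1]
          simp
  · intro k r hr c hc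
    by_cases hkv : k.num < v.num
    · rw [hd0 k.num hkv] at hr
      omega
    by_cases hk2 : w.num ≤ k.num ∧ k.num ≤ n - 2
    · rw [hd2 k.num hk2.1 hk2.2] at hr hc
      have a1 : α (V.transport k w (V.transport P k x)) = 1 := by
        rw [V.transport_trans (hPr k (by omega)) (hrw k hk2.1 (by omega)), hα, hφ]
      have a2 : α (V.transport k w (V.transport R k y)) = 0 := by
        rw [V.transport_trans (hRr k (by omega)) (hrw k hk2.1 (by omega)), hα']
      have p1 : φ (V.transport k v (V.transport P k x)) = 1 := by
        rw [V.transport_trans (hPr k (by omega)) (hrv k (by omega)), hφ]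
      have p2 : φ (V.transport k v (V.transport R k y)) = 1 := by
        rw [V.transport_trans (hRr k (by omega)) (hrv k (by omega)), hφR (by omega)]
      interval_cases r <;> interval_cases c <;>
        simp [hΨ0 k hk2.1 hk2.2, hΨ1 k hk2.1 hk2.2, hY0 k (by omega), hY1 k (by omega), a1, a2,
          p1, p2]
    · have hkn := k.le_n
      rw [hd, if_neg hk2, if_pos (by omega)] at hr hc
      obtain rfl : r = 0 := by omega
      obtain rfl : c = 0 := by omega
      rw [if_pos rfl, hΨ k (by omega)]
      by_cases hkR : k.num = n
      · obtain rfl : k = R := DVertex.ext_num (by omega)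
        rw [hYR, ← hxy v hvw hvn, hφ]
      · rw [hY0 k (by omega), V.transport_trans (hPr k (by omega)) (hrv k (by omega)), hφ]

end QuiverRep

/-! ### Every indecomposable comes from a curve -/

namespace QuiverRep

variable {K : Type u} [Field K] {n : ℕ} {V : QuiverRep K (DVertex n)}

/-- Generation by incoming arrows, iterated downwards from `n - 2`, leaves only `V_P` and `V_R` as
generators. -/
theorem range_sup_range_eq_top {P R : DVertex n} (hP : P.num = n - 1) (hR : R.num = n)
    (hgen : ∀ g : DVertex n, g.num ≤ n - 2 → ∀ I : Submodule K (V.space g),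
      (∀ (a : DVertex n) (f : a ⟶ g) x, V.map f x ∈ I) → I = ⊤)
    (k : DVertex n) (hk : k.num ≤ n - 2) :
    LinearMap.range (V.transport P k) ⊔ LinearMap.range (V.transport R k) = ⊤ := by
  refine DVertex.chain_induction (i := 1) (t := n - 2)
    (P := fun k => LinearMap.range (V.transport P k) ⊔ LinearMap.range (V.transport R k) = ⊤)
    ?_ (by omega) ?_ k k.one_le hk
  · intro g hg
    refine hgen g (by omega) _ fun a f x => ?_
    rw [map_eq_transport]
    rcases DVertex.arrow_iff f with ⟨ha, -⟩ | ⟨ha, -⟩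
    · obtain rfl : a = P := DVertex.ext_num (by omega)
      exact Submodule.mem_sup_left ⟨x, rfl⟩
    · obtain rfl : a = R := DVertex.ext_num (by omega)
      exact Submodule.mem_sup_right ⟨x, rfl⟩
  · intro a b f hab _ hat ha
    refine hgen b (by omega) _ fun a' f' x => ?_
    obtain rfl : a' = a := DVertex.ext_num (by
      rcases DVertex.arrow_iff f' with h | h <;> omega)
    have hx : x ∈ LinearMap.range (V.transport P a') ⊔ LinearMap.range (V.transport R a') :=
      ha ▸ Submodule.mem_top
    obtain ⟨_, ⟨p, rfl⟩, _, ⟨r, rfl⟩, rfl⟩ := Submodule.mem_sup.mp hx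
    rw [map_add, V.map_transport (by unfold DVertex.Reaches; omega),
      V.map_transport (by unfold DVertex.Reaches; omega)]
    exact Submodule.add_mem_sup ⟨p, rfl⟩ ⟨r, rfl⟩

theorem exists_ne_zero_of_not_injective {X Y : Type u} [AddCommGroup X] [Module K X]
    [AddCommGroup Y] [Module K Y] {f : X →ₗ[K] Y} (hf : ¬ Function.Injective f) :
    ∃ x, x ≠ 0 ∧ f x = 0 := by
  by_contra! h
  exact hf ((injective_iff_map_eq_zero f).mpr fun x hx => by_contra fun h0 => h x h0 hx)

/-- A nonzero vector of `V_g` killed by the only arrow leaving `g` spans a simple summand, as no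
arrow ends at `g`. -/
theorem IsIndecomposable.exists_isIso_of_kernel (hV : V.IsIndecomposable) (hn : 4 ≤ n)
    {g k : DVertex n} (hg : n - 1 ≤ g.num) (hk : k.num = n - 2)
    (h : ¬ Function.Injective (V.transport g k)) :
    ∃ i j, IsEssentialPair n i j ∧ V.IsIso (repOfEnds K n i j) := by
  obtain ⟨x, hx0, hx⟩ := exists_ne_zero_of_not_injective h
  obtain ⟨φ, hφ, -⟩ := exists_functional_of_notMem (p := (⊥ : Submodule K (V.space g))) (x := x)
    (by simpa using hx0)
  refine hV.exists_isIso_of_puncture hn hg (Or.inl rfl) x (fun b f => ?_) φ (by simpa using hφ)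
    fun a ha hag hr => by unfold DVertex.Reaches at hr; omega
  obtain rfl : b = k := DVertex.ext_num (by
    have := DVertex.arrow_iff f
    omega)
  exact hx

/-- Every indecomposable representation of `Q^n` is isomorphic to the representation of a curve. -/
theorem IsIndecomposable.exists_isIso_repOfEnds (hV : V.IsIndecomposable) (hn : 4 ≤ n) :
    ∃ i j, IsEssentialPair n i j ∧ V.IsIso (repOfEnds K n i j) := by
  by_cases hgen : ∀ g : DVertex n, g.num ≤ n - 2 → ∀ I : Submodule K (V.space g),
      (∀ (a : DVertex n) (f : a ⟶ g) x, V.map f x ∈ I) → I = ⊤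
  swap
  · push Not at hgen
    obtain ⟨g, hg, I, hI, hI'⟩ := hgen
    exact hV.exists_isIso_of_incoming g hg I hI hI'
  obtain ⟨P, hP⟩ : ∃ P : DVertex n, P.num = n - 1 := ⟨.ofNum (n - 1) (by omega) (by omega), rfl⟩
  obtain ⟨R, hR⟩ : ∃ R : DVertex n, R.num = n := ⟨.ofNum n (by omega) (by omega), rfl⟩
  obtain ⟨m, hm⟩ : ∃ m : DVertex n, m.num = n - 2 := ⟨.ofNum (n - 2) (by omega) (by omega), rfl⟩
  by_cases hPm : Function.Injective (V.transport P m)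
  swap
  · exact hV.exists_isIso_of_kernel hn (by omega) hm hPm
  by_cases hRm : Function.Injective (V.transport R m)
  swap
  · exact hV.exists_isIso_of_kernel hn (by omega) hm hRm
  have hPr : ∀ k : DVertex n, k.num ≤ n - 1 → P.Reaches k := fun k _ => by
    unfold DVertex.Reaches; omega
  have hRr : ∀ k : DVertex n, k.num ≤ n - 2 → R.Reaches k := fun k _ => by
    unfold DVertex.Reaches; omega
  have hr : ∀ a b : DVertex n, b.num ≤ a.num → b.num ≤ n - 2 → a.Reaches b := fun a b _ _ => by
    unfold DVertex.Reaches; omega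
  -- Injectivity at `i` lets vectors of `V_P` and `V_R` be recovered from their images at `v`;
  -- minimality provides a vector that dies just below.
  obtain ⟨i, ⟨hi1, hin, hinj⟩, hmin⟩ := Int.exists_least_of_bdd
    (P := fun z => 1 ≤ z ∧ z ≤ n - 2 ∧ ∀ k : DVertex n, k.num = z →
      Function.Injective (V.transport P k) ∧ Function.Injective (V.transport R k))
    ⟨1, fun z hz => hz.1⟩ ⟨n - 2, by omega, le_rfl, fun k hk => by
      obtain rfl : k = m := DVertex.ext_num (by omega)
      exact ⟨hPm, hRm⟩⟩
  obtain ⟨v, hv⟩ : ∃ v : DVertex n, v.num = i := ⟨.ofNum i (by omega) (by omega), rfl⟩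
  obtain ⟨hPv, hRv⟩ := hinj v hv
  have hZ : (∃ x : V.space P, x ≠ 0 ∧ ∀ k : DVertex n, k.num < v.num → V.transport P k x = 0) ∨
      ∃ y : V.space R, y ≠ 0 ∧ ∀ k : DVertex n, k.num < v.num → V.transport R k y = 0 := by
    -- There is nothing below vertex 1, so any nonzero vector will do; one exists because `V_P` and
    -- `V_R` generate `V ≠ 0`.
    by_cases hi : i = 1
    · by_contra! hne
      have hP0 : ∀ x : V.space P, x = 0 := fun x => by_contra fun hx => by
        obtain ⟨k, hk, -⟩ := hne.1 x hx
        have := k.one_le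
        omega
      have hR0 : ∀ x : V.space R, x = 0 := fun x => by_contra fun hx => by
        obtain ⟨k, hk, -⟩ := hne.2 x hx
        have := k.one_le
        omega
      refine hV.1 fun k => subsingleton_of_forall_eq 0 fun x => ?_
      have hkn := k.le_n
      by_cases hk : k.num ≤ n - 2
      · have hx : x ∈ LinearMap.range (V.transport P k) ⊔ LinearMap.range (V.transport R k) :=
          range_sup_range_eq_top hP hR hgen k hk ▸ Submodule.mem_top
        obtain ⟨_, ⟨p, rfl⟩, _, ⟨r, rfl⟩, rfl⟩ := Submodule.mem_sup.mp hx
        rw [hP0 p, hR0 r, map_zero, map_zero, add_zero]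
      · by_cases hkP : k.num = n - 1
        · obtain rfl : k = P := DVertex.ext_num (by omega)
          exact hP0 x
        · obtain rfl : k = R := DVertex.ext_num (by omega)
          exact hR0 x
    · obtain ⟨b, hb⟩ : ∃ b : DVertex n, b.num = i - 1 :=
        ⟨.ofNum (i - 1) (by omega) (by omega), rfl⟩
      by_cases hPb : Function.Injective (V.transport P b)
      · right
        have hRb : ¬ Function.Injective (V.transport R b) := fun hRb => by
          have := hmin (i - 1) ⟨by omega, by omega, fun k hk => by
            obtain rfl : k = b := DVertex.ext_num (by omega)
            exact ⟨hPb, hRb⟩⟩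
          omega
        obtain ⟨y, hy0, hy⟩ := exists_ne_zero_of_not_injective hRb
        exact ⟨y, hy0, fun k hk => by
          rw [← V.transport_trans (hRr b (by omega)) (hr b k (by omega) (by omega)), hy, map_zero]⟩
      · left
        obtain ⟨x, hx0, hx⟩ := exists_ne_zero_of_not_injective hPb
        exact ⟨x, hx0, fun k hk => by
          rw [← V.transport_trans (hPr b (by omega)) (hr b k (by omega) (by omega)), hx, map_zero]⟩
  have hout : ∀ b : DVertex n, (v ⟶ b) → b.num < v.num := fun b f => by
    have := DVertex.arrow_iff f
    omega
  by_cases c1 : ∃ x : V.space P, (∀ k : DVertex n, k.num < v.num → V.transport P k x = 0) ∧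
      V.transport P v x ∉ LinearMap.range (V.transport R v)
  · obtain ⟨x, hx, hxR⟩ := c1
    obtain ⟨φ, hφ, hφR⟩ := exists_functional_of_notMem hxR
    refine hV.exists_isIso_of_puncture hn (by omega) (hPr v (by omega)) x
      (fun b f => hx b (hout b f)) φ hφ fun a ha haP har z => hφR _ ?_
    have := a.le_n
    obtain rfl : a = R := DVertex.ext_num (by omega)
    exact ⟨z, rfl⟩
  by_cases c2 : ∃ y : V.space R, (∀ k : DVertex n, k.num < v.num → V.transport R k y = 0) ∧
      V.transport R v y ∉ LinearMap.range (V.transport P v)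
  · obtain ⟨y, hy, hyP⟩ := c2
    obtain ⟨φ, hφ, hφP⟩ := exists_functional_of_notMem hyP
    refine hV.exists_isIso_of_puncture hn (by omega) (hRr v (by omega)) y
      (fun b f => hy b (hout b f)) φ hφ fun a ha haR har z => hφP _ ?_
    have := a.le_n
    obtain rfl : a = P := DVertex.ext_num (by omega)
    exact ⟨z, rfl⟩
  push Not at c1 c2
  -- By symmetry the dying vector may be taken in `V_P`: a match at `v` forces the same behaviour
  -- below `v`, and injectivity at `v` keeps it nonzero.
  have hstart : ∃ x : V.space P, x ≠ 0 ∧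
      (∀ k : DVertex n, k.num < v.num → V.transport P k x = 0) ∧
      ∃ y : V.space R, V.transport P v x = V.transport R v y := by
    rcases hZ with ⟨x, hx0, hx⟩ | ⟨y, hy0, hy⟩
    · obtain ⟨y, hy⟩ := c1 x hx
      exact ⟨x, hx0, hx, y, hy.symm⟩
    · obtain ⟨x, hx⟩ := c2 y hy
      refine ⟨x, ?_, fun k hk => ?_, y, hx⟩
      · rintro rfl
        rw [map_zero] at hx
        exact hy0 (hRv (hx.symm.trans (map_zero _).symm))
      · rw [← V.transport_trans (hPr v (by omega)) (hr v k (by omega) (by omega)), hx,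
          V.transport_trans (hRr v (by omega)) (hr v k (by omega) (by omega)), hy k hk]
  -- The pair is chosen to agree up to the highest possible vertex `z`; the first vertex without
  -- agreement, `w = z + 1`, gives the endpoint `-w`.
  obtain ⟨z, ⟨hiz, hzn, x, hx0, hx, y, hxy⟩, hmax⟩ := Int.exists_greatest_of_bdd
    (P := fun z => i ≤ z ∧ z ≤ n - 2 ∧ ∃ x : V.space P, x ≠ 0 ∧
      (∀ k : DVertex n, k.num < v.num → V.transport P k x = 0) ∧
      ∃ y : V.space R, ∀ k : DVertex n, k.num = z → V.transport P k x = V.transport R k y)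
    ⟨n - 2, fun z hz => hz.2.1⟩ (by
      obtain ⟨x, hx0, hx, y, hxy⟩ := hstart
      exact ⟨i, le_rfl, hin, x, hx0, hx, y, fun k hk => by
        obtain rfl : k = v := DVertex.ext_num (by omega)
        exact hxy⟩)
  obtain ⟨w, hw⟩ : ∃ w : DVertex n, w.num = z + 1 := ⟨.ofNum (z + 1) (by omega) (by omega), rfl⟩
  obtain ⟨t, ht⟩ : ∃ t : DVertex n, t.num = z := ⟨.ofNum z (by omega) (by omega), rfl⟩
  have hxy' : ∀ k : DVertex n, k.num < w.num → k.num ≤ n - 2 →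
      V.transport P k x = V.transport R k y := fun k hk _ => by
    rw [← V.transport_trans (hPr t (by omega)) (hr t k (by omega) (by omega)), hxy t ht,
      V.transport_trans (hRr t (by omega)) (hr t k (by omega) (by omega))]
  have hwv := hr w v (by omega) (by omega)
  have hinf : ∀ u ∈ LinearMap.range (V.transport P w) ⊓ LinearMap.range (V.transport R w),
      V.transport w v u ≠ V.transport P v x := by
    rintro u ⟨⟨x', rfl⟩, y', hy'⟩ hu
    by_cases hwn : w.num ≤ n - 2
    · rw [V.transport_trans (hPr w (by omega)) hwv] at hu
      obtain rfl := hPv hu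
      have := hmax (z + 1) ⟨by omega, by omega, x', hx0, hx, y', fun k hk => by
        obtain rfl : k = w := DVertex.ext_num (by omega)
        exact hy'.symm⟩
      omega
    -- Now `w = n - 1`, which `n` does not reach, so the range from `R` is zero.
    · rw [V.transport_eq_zero (by unfold DVertex.Reaches; omega)] at hy'
      rw [← hy', map_zero] at hu
      exact hx0 (hPv (hu.symm.trans (map_zero _).symm))
  have hmem : V.transport P v x ∉
      (LinearMap.range (V.transport P w) ⊓ LinearMap.range (V.transport R w)).map
        (V.transport w v) := by
    rintro ⟨u, hu, hux⟩
    exact hinf u hu hux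
  -- Since `φ` kills the image of the intersection of the two ranges at `w`, its pullback to `w` can
  -- be kept on the range from `P` and replaced by zero on the range from `R`; this is `α`.
  obtain ⟨φ, hφ, hφI⟩ := exists_functional_of_notMem hmem
  obtain ⟨α, hα, hα'⟩ := exists_functional_eq_on (φ ∘ₗ V.transport w v)
    fun u hu => hφI _ (Submodule.mem_map_of_mem hu)
  exact ⟨_, _, hV.isIso_of_neg hP hR (by omega) (by omega) (by omega) x y hxy' hx φ hφ α
    (fun u => (hα _ ⟨u, rfl⟩).trans (congrArg φ (V.transport_trans (hPr w (by omega)) hwv u)))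
    fun u => hα' _ ⟨u, rfl⟩⟩

end QuiverRep

/-! ### Curve classes as essential pairs, and the bijection -/

namespace CurveClass

variable {n : ℕ}

/-- One of `j` and `-j` is a positive endpoint in the class, through `γ` or its opposite, so
minimality of `i` gives `i ≤ |j|`. Equality is excluded by `j ≠ ± i`. -/
theorem HasEssentialEnds.isEssentialPair {c : CurveClass n} {i j : ℤ}
    (h : c.HasEssentialEnds i j) : IsEssentialPair n i j := by
  obtain ⟨⟨γ, hγ, he⟩, hi, hmin⟩ := h
  obtain ⟨a, b, ha, hb, hab, hab', he', -⟩ := γ.isGeodesic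
  unfold IsLabel at ha hb
  have h1 : 0 < j → i ≤ j := fun hj => hmin γ hγ j (by simp [he]) hj
  have h2 : 0 < -j → i ≤ -j := fun hj => by
    refine hmin (GeodesicCurve.mk' (-a) (-b) (by simpa [IsLabel] using ha)
      (by simpa [IsLabel] using hb) (by omega) (by omega)) ?_ (-j) ?_ hj
    · rw [← hγ]
      refine Quotient.sound (Or.inr (GeodesicCurve.IsOpposite.symm ?_))
      simp [GeodesicCurve.IsOpposite, GeodesicCurve.mk', he']
    · have : (GeodesicCurve.mk' (n := n) (-a) (-b) (by simpa [IsLabel] using ha)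
        (by simpa [IsLabel] using hb) (by omega) (by omega)).ends = Sym2.map Neg.neg s(i, j) := by
        rw [← he, he']
        simp [GeodesicCurve.mk']
      rw [this]
      simp
  rw [he, Sym2.eq_iff] at he'
  unfold IsEssentialPair
  grind

end CurveClass

theorem IsEssentialPair.exists_hasEssentialEnds {n : ℕ} {i j : ℤ} (h : IsEssentialPair n i j) :
    ∃ c : CurveClass n, c.HasEssentialEnds i j := by
  obtain ⟨h1, h2, h3, h4⟩ := h
  let γ : GeodesicCurve n := GeodesicCurve.mk' i j (by unfold IsLabel; grind)
    (by unfold IsLabel; grind) (by grind) (by grind)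
  have he : γ.ends = s(i, j) := rfl
  refine ⟨⟦γ⟧, ⟨γ, rfl, he⟩, by omega, fun δ hδ k hk hk0 => ?_⟩
  rcases Quotient.exact hδ.symm with rfl | h
  · rw [he, Sym2.mem_iff] at hk
    grind
  · rw [show δ.ends = _ from h, he, Sym2.map_mk, Sym2.mem_iff] at hk
    grind

theorem CurveClass.eq_of_hasEssentialEnds {n : ℕ} {c c' : CurveClass n} {i j : ℤ}
    (h : c.HasEssentialEnds i j) (h' : c'.HasEssentialEnds i j) : c = c' := by
  obtain ⟨⟨γ, rfl, he⟩, -⟩ := h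
  obtain ⟨⟨δ, rfl, he'⟩, -⟩ := h'
  rw [GeodesicCurve.ext_ends (he.trans he'.symm)]

theorem finrank_repOfEnds (K : Type u) [Field K] (n : ℕ) (i j : ℤ) (k : DVertex n) :
    Module.finrank K ((repOfEnds K n i j).space k) = curveDim n i j k.num :=
  Module.finrank_fin_fun K

theorem lemma3p2 (K : Type u) [Field K] [IsAlgClosed K] (n : ℕ) (hn : 4 ≤ n) :
    Set.BijOn
      (fun c : CurveClass n => (⟦curveRep K c⟧ : QuiverRep.IsoClass K (DVertex n)))
      Set.univ
      {x : QuiverRep.IsoClass K (DVertex n) |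
        ∃ V : QuiverRep K (DVertex n), V.IsIndecomposable ∧ x = ⟦V⟧} := by
  refine ⟨fun c _ => ⟨_, c.hasEssentialEnds.isEssentialPair.isIndecomposable K, rfl⟩,
    fun c _ c' _ h => ?_, ?_⟩
  · have hiso : (curveRep K c).IsIso (curveRep K c') := Quotient.exact h
    have hc := c.hasEssentialEnds
    have hc' := c'.hasEssentialEnds
    -- Isomorphic representations have equal dimension vectors, hence equal essential endpoints.
    obtain ⟨h1, h2⟩ := hc.isEssentialPair.eq_of_curveDim_eq hc'.isEssentialPair fun k hk hk' => by
      have := hiso.finrank_eq (.ofNum k hk hk')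
      exact (finrank_repOfEnds K n _ _ _).symm.trans (this.trans (finrank_repOfEnds K n _ _ _))
    rw [← h1, ← h2] at hc'
    exact CurveClass.eq_of_hasEssentialEnds hc hc'
  · rintro _ ⟨V, hV, rfl⟩
    obtain ⟨i, j, hij, hiso⟩ := hV.exists_isIso_repOfEnds hn
    obtain ⟨c, hc⟩ := hij.exists_hasEssentialEnds
    have he : c.essentialEnds = (i, j) :=
      c.existsUnique_essentialEnds.unique c.hasEssentialEnds hc
    refine ⟨c, trivial, Quotient.sound ?_⟩
    change (repOfEnds K n c.essentialEnds.1 c.essentialEnds.2).IsIso V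
    rw [he]
    exact hiso.symm
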